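/- Let $A\in\mathbb C^{n_P\times n_P}$, $B_w\in\mathbb C^{n_P\times n_w}$, $B_u\in\mathbb C^{n_P\times n_u}$, $C_z\in\mathbb C^{n_z\times n_P}$, $C_y\in\mathbb C^{n_u\times n_P}$, $D_{uz}\in\mathbb C^{n_z\times n_u}$, $D_{uy}\in\mathbb C^{n_u\times n_u}$, and let $\mathcal P:\{w,u\}\mapsto\{z,y\}$ be the causal linear time-invariant plant with joint realization $$\left[\begin{array}{c|cc}A&B_w&B_u\\\hline C_z&0&D_{uz}\\C_y&0&D_{uy}\end{array}\right].$$ Assume that this realization is minimal; that $\mathcal P$ has bounded $L_2$ gain, i.e. there is $\gamma>0$ with $\|y\|_{L_2}^2+\|z\|_{L_2}^2\le\gamma^2(\|w\|_{L_2}^2+\|u\|_{L_2}^2)$ for all $w,u\in L_2(\mathbb R)$; and that $u\mapsto y$ is passive, i.e. there is a function $\beta:L_2\to\mathbb R_{>0}$ with $\int_{-\infty}^\infty (u^Hy+y^Hu)\,dt\ge-\beta(w)$ for all $w,u\in L_2(\mathbb R)$. Let $\epsilon,\tau>0$. Put $\hat P_{uy}(s)=C_y(sI-A)^{-1}B_u+D_{uy}$,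 $\tilde P_{uy}(q)=\hat P_{uy}\!\left(\frac1{2\tau}\frac{q-1}{q+1}\right)$ and $$\Phi=(I+2\tau A)(I-2\tau A)^{-1},\quad \Gamma_u=2\tau(I-2\tau A)^{-1}B_u,\quad \Pi_y=2C_y(I-2\tau A)^{-1},\quad \Delta_{uy}=D_{uy}+2\tau C_y(I-2\tau A)^{-1}B_u .$$ Let $\tilde{\mathbb H}_\infty$ be the set of matrix functions that are analytic and uniformly bounded on $|q|>1$. For a transfer function $\tilde G$ let $\tilde G^{\sim}(q)=\tilde G(1/\bar q)^H$ be its para-Hermitian conjugate, which equals the conjugate transpose $\tilde G(q)^H$ for $|q|=1$. Then: (1) There exist $\Sigma_P=\Sigma_P^H\succeq0$, $\Pi_S\in\mathbb C^{n_u\times n_P}$ and $\Delta_S\in\mathbb C^{n_u\times n_u}$ such that $$\begin{bmatrix}\Phi^H\Sigma_P\Phi-\Sigma_P&\Phi^H\Sigma_P\Gamma_u-\Pi_y^H\\ \Gamma_u^H\Sigma_P\Phi-\Pi_y&\Gamma_u^H\Sigma_P\Gamma_u-\Delta_{uy}-\Delta_{uy}^H-\epsilon I\end{bmatrix}=-\begin{bmatrix}\Pi_S^H\\\Delta_S^H\end{bmatrix}\begin{bmatrix}\Pi_S&\Delta_S\end{bmatrix}\qquad(*)$$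 and such that the spectral factor $\tilde S(q)=\Pi_S(qI-\Phi)^{-1}\Gamma_u+\Delta_S$ satisfies $\tilde S,\tilde S^{-1}\in\tilde{\mathbb H}_\infty$. (2) For every such triple $(\Sigma_P,\Pi_S,\Delta_S)$ the matrix $\Delta_S$ is invertible. With $\Phi_F=\Phi-\Gamma_u\Delta_S^{-1}\Pi_S$, the Stein equation $$\Sigma_F=\Phi_F\Sigma_F\Phi_F^H+\Gamma_u\Delta_S^{-1}\Delta_S^{-H}\Gamma_u^H$$ has exactly one solution $\Sigma_F$, and $\Sigma_F=\Sigma_F^H$. Put $$\Gamma_F=\left[\Gamma_u\Delta_S^{-1}-\Phi_F\Sigma_F\Pi_S^H\right]\Delta_S^{-H},\quad \Pi_F=-\Delta_S^{-1}\Pi_S,\quad \Delta_F=\tfrac12\Delta_S^{-1}\left[I+\Pi_S\Sigma_F\Pi_S^H\right]\Delta_S^{-H}$$ and $\tilde F(q)=\Pi_F(qI-\Phi_F)^{-1}\Gamma_F+\Delta_F$. Then $\tilde F,\tilde F^{-1}\in\tilde{\mathbb H}_\infty$, and $$\left[\tilde P_{uy}(q)+\tilde P_{uy}^{\sim}(q)+\epsilon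 I\right]^{-1}=\tilde F^{\sim}(q)+\tilde F(q)$$ for every $|q|>1$ such that $1/\bar q$ is an eigenvalue of neither $\Phi$ nor $\Phi_F$ (that is, for all but finitely many $|q|>1$), and $$\left[\tilde P_{uy}(q)+\tilde P_{uy}(q)^H+\epsilon I\right]^{-1}=\tilde F(q)^H+\tilde F(q)$$ for every $|q|=1$, $q\ne-1$; in both cases the matrix in brackets on the left is invertible. -/

import Mathlib

open MeasureTheory Matrix
open scoped ComplexOrder

/-- A state-space quadruple `[A | B ; C | D]` with complex entries, with state, input and output
indices `ι`, `m`, `p`. -/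
structure Realization (ι m p : Type) where
  A : Matrix ι ι ℂ
  B : Matrix ι m ℂ
  C : Matrix p ι ℂ
  D : Matrix p m ℂ

/-- The transfer function `C (s I - A)⁻¹ B + D`; it is meaningful at `s ∉ spectrum ℂ A`. -/
noncomputable def Realization.transfer {ι m p : Type} [Fintype ι] [DecidableEq ι]
    (G : Realization ι m p) (s : ℂ) : Matrix p m ℂ :=
  G.C * (s • (1 : Matrix ι ι ℂ) - G.A)⁻¹ * G.B + G.D

/-- A realization is minimal if no realization with the same transfer function has a smaller
state dimension. -/
def Realization.IsMinimal {n : ℕ} {m p : Type} (G : Realization (Fin n) m p) : Prop :=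
  ∀ (k : ℕ) (G' : Realization (Fin k) m p),
    (∀ s : ℂ, s ∉ spectrum ℂ G.A → s ∉ spectrum ℂ G'.A → G'.transfer s = G.transfer s) → n ≤ k

/-- The continuous-time plant `{w, u} ↦ {z, y}`, with
`x' = A x + Bw w + Bu u`, `z = Cz x + Duz u`, `y = Cy x + Duy u`. -/
structure Plant (nP nw nu nz : ℕ) where
  A : Matrix (Fin nP) (Fin nP) ℂ
  Bw : Matrix (Fin nP) (Fin nw) ℂ
  Bu : Matrix (Fin nP) (Fin nu) ℂ
  Cz : Matrix (Fin nz) (Fin nP) ℂ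
  Cy : Matrix (Fin nu) (Fin nP) ℂ
  Duz : Matrix (Fin nz) (Fin nu) ℂ
  Duy : Matrix (Fin nu) (Fin nu) ℂ

/-- The squared `L²` norm `∫ ‖x(t)‖₂² dt` of a square-integrable signal. -/
noncomputable def signalNormSq {n : ℕ} (x : ℝ → Fin n → ℂ) : ℝ :=
  ∫ t, ∑ i, ‖x t i‖ ^ 2

namespace Plant

variable {nP nw nu nz : ℕ} (P : Plant nP nw nu nz)

/-- The joint realization of all four channels `{w, u} ↦ {z, y}`. -/
def toRealization : Realization (Fin nP) (Fin nw ⊕ Fin nu) (Fin nz ⊕ Fin nu) where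
  A := P.A
  B := Matrix.fromCols P.Bw P.Bu
  C := Matrix.fromRows P.Cz P.Cy
  D := Matrix.fromBlocks 0 P.Duz 0 P.Duy

/-- The integrand `C e^{A (t - σ)} (Bw w(σ) + Bu u(σ))` of the causal convolution. -/
noncomputable def kernel {p : ℕ} (C : Matrix (Fin p) (Fin nP) ℂ)
    (w : ℝ → Fin nw → ℂ) (u : ℝ → Fin nu → ℂ) (t σ : ℝ) : Fin p → ℂ :=
  (C * NormedSpace.exp (((t - σ : ℝ) : ℂ) • P.A)) *ᵥ (P.Bw *ᵥ w σ + P.Bu *ᵥ u σ)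

/-- The output `z` of the plant: convolution of the inputs with the impulse response. -/
noncomputable def outZ (w : ℝ → Fin nw → ℂ) (u : ℝ → Fin nu → ℂ) (t : ℝ) : Fin nz → ℂ :=
  (∫ σ in Set.Iic t, P.kernel P.Cz w u t σ) + P.Duz *ᵥ u t

/-- The output `y` of the plant: convolution of the inputs with the impulse response. -/
noncomputable def outY (w : ℝ → Fin nw → ℂ) (u : ℝ → Fin nu → ℂ) (t : ℝ) : Fin nu → ℂ :=
  (∫ σ in Set.Iic t, P.kernel P.Cy w u t σ) + P.Duy *ᵥ u t

/-- Bounded `L²` gain: square-integrable inputs on the whole time axis give well-defined,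
square-integrable outputs, with `‖y‖² + ‖z‖² ≤ γ² (‖w‖² + ‖u‖²)`. -/
def HasBoundedGain : Prop :=
  ∃ γ : ℝ, 0 < γ ∧ ∀ (w : ℝ → Fin nw → ℂ) (u : ℝ → Fin nu → ℂ),
    MemLp w 2 volume → MemLp u 2 volume →
      (∀ t, IntegrableOn (P.kernel P.Cz w u t) (Set.Iic t) volume) ∧
      (∀ t, IntegrableOn (P.kernel P.Cy w u t) (Set.Iic t) volume) ∧
      MemLp (P.outZ w u) 2 volume ∧ MemLp (P.outY w u) 2 volume ∧
      signalNormSq (P.outY w u) + signalNormSq (P.outZ w u)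
        ≤ γ ^ 2 * (signalNormSq w + signalNormSq u)

/-- Passivity of `u ↦ y`: `∫ (uᴴ y + yᴴ u) dt ≥ -β(w)`. The integrand is real-valued. -/
def IsPassive : Prop :=
  ∃ β : (ℝ → Fin nw → ℂ) → ℝ, (∀ w, 0 < β w) ∧
    ∀ (w : ℝ → Fin nw → ℂ) (u : ℝ → Fin nu → ℂ),
      MemLp w 2 volume → MemLp u 2 volume →
        -β w ≤ ∫ t, (star (u t) ⬝ᵥ P.outY w u t + star (P.outY w u t) ⬝ᵥ u t).re

/-- The Laplace-domain transfer function of the channel `u ↦ y`. -/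
noncomputable def hatPuy (s : ℂ) : Matrix (Fin nu) (Fin nu) ℂ :=
  Realization.transfer ⟨P.A, P.Bu, P.Cy, P.Duy⟩ s

/-- The discrete-time transfer function obtained from `hatPuy` by the bilinear transformation
`s = (q - 1) / (2 τ (q + 1))`; it is meaningful at `q ≠ -1`. -/
noncomputable def tildePuy (τ : ℝ) (q : ℂ) : Matrix (Fin nu) (Fin nu) ℂ :=
  P.hatPuy (1 / (2 * (τ : ℂ)) * ((q - 1) / (q + 1)))

/-- `Φ = (I + 2τA)(I - 2τA)⁻¹`. -/
noncomputable def Phi (τ : ℝ) : Matrix (Fin nP) (Fin nP) ℂ :=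
  (1 + (2 * (τ : ℂ)) • P.A) * (1 - (2 * (τ : ℂ)) • P.A)⁻¹

/-- `Γ_u = 2τ (I - 2τA)⁻¹ B_u`. -/
noncomputable def GammaU (τ : ℝ) : Matrix (Fin nP) (Fin nu) ℂ :=
  (2 * (τ : ℂ)) • ((1 - (2 * (τ : ℂ)) • P.A)⁻¹ * P.Bu)

/-- `Π_y = 2 C_y (I - 2τA)⁻¹`. -/
noncomputable def PiY (τ : ℝ) : Matrix (Fin nu) (Fin nP) ℂ :=
  (2 : ℂ) • (P.Cy * (1 - (2 * (τ : ℂ)) • P.A)⁻¹)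

/-- `Δ_uy = D_uy + 2τ C_y (I - 2τA)⁻¹ B_u`. -/
noncomputable def DeltaUY (τ : ℝ) : Matrix (Fin nu) (Fin nu) ℂ :=
  P.Duy + (2 * (τ : ℂ)) • (P.Cy * (1 - (2 * (τ : ℂ)) • P.A)⁻¹ * P.Bu)

/-- The matrices `Σ_P = Σ_Pᴴ ⪰ 0`, `Π_S` and `Δ_S` (square) solve the discrete-time
positive-real factorization equation of the channel `u ↦ y` with margin `ε`. -/
def IsPRFactorization (ε τ : ℝ) (SigP : Matrix (Fin nP) (Fin nP) ℂ)
    (PiS : Matrix (Fin nu) (Fin nP) ℂ) (DelS : Matrix (Fin nu) (Fin nu) ℂ) : Prop :=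
  SigP.PosSemidef ∧
  Matrix.fromBlocks
      ((P.Phi τ)ᴴ * SigP * P.Phi τ - SigP)
      ((P.Phi τ)ᴴ * SigP * P.GammaU τ - (P.PiY τ)ᴴ)
      ((P.GammaU τ)ᴴ * SigP * P.Phi τ - P.PiY τ)
      ((P.GammaU τ)ᴴ * SigP * P.GammaU τ - P.DeltaUY τ - (P.DeltaUY τ)ᴴ
        - (ε : ℂ) • (1 : Matrix (Fin nu) (Fin nu) ℂ))
    = -(Matrix.fromRows PiSᴴ DelSᴴ * Matrix.fromCols PiS DelS)

/-- The realization `[Φ | Γ_u ; Π_S | Δ_S]` of the spectral factor. -/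
noncomputable def spectralFactor (τ : ℝ) (PiS : Matrix (Fin nu) (Fin nP) ℂ)
    (DelS : Matrix (Fin nu) (Fin nu) ℂ) : Realization (Fin nP) (Fin nu) (Fin nu) :=
  ⟨P.Phi τ, P.GammaU τ, PiS, DelS⟩

end Plant

/-- The class `H∞` of the exterior of the unit disc: analytic and uniformly bounded on `|q| > 1`.
Boundedness is stated entrywise, which agrees with boundedness in any matrix norm. -/
def IsHInfty {n m : ℕ} (G : ℂ → Matrix (Fin n) (Fin m) ℂ) : Prop :=
  (∀ i j, AnalyticOnNhd ℂ (fun q => G q i j) {q : ℂ | 1 < ‖q‖}) ∧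
  ∃ M : ℝ, ∀ q : ℂ, 1 < ‖q‖ → ∀ i j, ‖G q i j‖ ≤ M

/-- `G` and `G⁻¹` both belong to `H∞`, the inverse existing at every `|q| > 1`. -/
def IsHInftyUnit {n : ℕ} (G : ℂ → Matrix (Fin n) (Fin n) ℂ) : Prop :=
  IsHInfty G ∧ (∀ q : ℂ, 1 < ‖q‖ → IsUnit (G q)) ∧ IsHInfty (fun q => (G q)⁻¹)

/-- The para-Hermitian conjugate `G^∼(q) = G(1 / q̄)ᴴ` with respect to the unit circle. For
`|q| = 1` it is the conjugate transpose `G(q)ᴴ`. -/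
noncomputable def paraConj {n : ℕ} (G : ℂ → Matrix (Fin n) (Fin n) ℂ) (q : ℂ) :
    Matrix (Fin n) (Fin n) ℂ :=
  (G ((star q)⁻¹))ᴴ

namespace Realization

variable {n m : ℕ} (S : Realization (Fin n) (Fin m) (Fin m))

/-- `Φ_F = Φ_S - Γ_S Δ_S⁻¹ Π_S`. -/
noncomputable def PhiF : Matrix (Fin n) (Fin n) ℂ :=
  S.A - S.B * S.D⁻¹ * S.C

/-- The Stein equation `Σ = Φ_F Σ Φ_Fᴴ + Γ_S Δ_S⁻¹ Δ_S⁻ᴴ Γ_Sᴴ`. -/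
def SteinEq (Sig : Matrix (Fin n) (Fin n) ℂ) : Prop :=
  Sig = S.PhiF * Sig * S.PhiFᴴ + S.B * S.D⁻¹ * (S.D⁻¹)ᴴ * S.Bᴴ

/-- The realization `[Φ_F | Γ_F ; Π_F | Δ_F]` built from `S` and `Σ_F`, where
`Γ_F = [Γ_S Δ_S⁻¹ - Φ_F Σ_F Π_Sᴴ] Δ_S⁻ᴴ`, `Π_F = -Δ_S⁻¹ Π_S` and
`Δ_F = ½ Δ_S⁻¹ [I + Π_S Σ_F Π_Sᴴ] Δ_S⁻ᴴ`. -/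
noncomputable def additiveFactor (Sig : Matrix (Fin n) (Fin n) ℂ) :
    Realization (Fin n) (Fin m) (Fin m) where
  A := S.PhiF
  B := (S.B * S.D⁻¹ - S.PhiF * Sig * S.Cᴴ) * (S.D⁻¹)ᴴ
  C := -(S.D⁻¹ * S.C)
  D := (1 / 2 : ℂ) • (S.D⁻¹ * (1 + S.C * Sig * S.Cᴴ) * (S.D⁻¹)ᴴ)

end Realization

/-! Stability. Bounded gain makes every impulse response of the plant convolvable with all of `L²`.
An eigenvector of `A` with `Re μ ≥ 0` is then invisible in the outputs, and minimality rules it out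
(`Plant.isUnit_smul_one_sub_A`). The bilinear map carries this to `Φ`, whose spectrum lies in the
open unit disc (`Plant.isSchur_Phi`).

Existence of the spectral factor. Testing passivity on sums of exponentials `e^{sᵢt}`, cut off at
time zero, shows that the Pick form of the transfer function is nonnegative (`Plant.pick_nonneg`),
and the Cayley transform gives its discrete version. Geometric sequences are total in `ℓ²` and have
the Szegő kernel as Gram matrix, so the Pick form is the quadratic form of a Toeplitz operator `T`,
whose real part is therefore nonnegative (`IsUnilateralShift.toeplitz_re_nonneg`). Hence `M = T + T†
+ ε` is coercive, and the linear-quadratic problem with Hessian `M` has a unique minimizer from each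
state. Its value and first sample give a stabilizing Riccati solution `P = O† M⁻¹ O`, `K = -e† M⁻¹
O`, with `O` the observability operator (`IsUnilateralShift.exists_riccati`). Factoring the positive
definite weight of that equation gives `Π_S` and `Δ_S`.

Additive factor. Let `S` be any admissible spectral factor. Boundedness of `S⁻¹` makes `Δ_S`
invertible and puts the spectrum of `Φ_F` in the open disc (`Realization.isSchur_PhiF`), so the
Stein equation has a unique solution, which is positive semidefinite. With it, `F(q) + F(p)ᴴ` equals
`S(q)⁻¹ S(p)⁻ᴴ` plus a term carrying the factor `q p̄ - 1` (`Realization.additiveFactor_add`). At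
reflected points the extra term vanishes, which with `P + P^∼ + ε = S^∼ S` gives the claimed
inverse. At `p = q` outside the disc it is positive semidefinite, so the Hermitian part of `F`
dominates `½ S⁻¹S⁻ᴴ`, which bounds `F⁻¹`. -/

/-! ### Toeplitz operators and the Riccati equation over an abstract unilateral shift. -/

section UnilateralShift

set_option linter.unusedSectionVars false

open scoped InnerProduct InnerProductSpace
open ContinuousLinearMap

variable {H E X : Type*} [NormedAddCommGroup H] [InnerProductSpace ℂ H] [CompleteSpace H]
  [NormedAddCommGroup E] [InnerProductSpace ℂ E] [CompleteSpace E]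
  [NormedAddCommGroup X] [InnerProductSpace ℂ X] [CompleteSpace X]

/-- `S` is the unilateral shift on `H`, with wandering subspace the isometric image of `E` under
`e`, and every operator on `E` extends diagonally to `H`. -/
structure IsUnilateralShift (S : H →L[ℂ] H) (e : E →L[ℂ] H) : Prop where
  inner_shift : ∀ f g, ⟪S f, S g⟫_ℂ = ⟪f, g⟫_ℂ
  inner_vac : ∀ u v, ⟪e u, e v⟫_ℂ = ⟪u, v⟫_ℂ
  inner_vac_shift : ∀ u f, ⟪e u, S f⟫_ℂ = 0
  decomp : ∀ f, ∃ u g, f = e u + S g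
  eq_zero : ∀ f, (∀ n u, ⟪(S ^ n) (e u), f⟫_ℂ = 0) → f = 0
  diag : ∀ A : E →L[ℂ] E, ∃ A' : H →L[ℂ] H, ‖A'‖ ≤ ‖A‖ ∧
    (∀ f, A' (S f) = S (A' f)) ∧ ∀ u, A' (e u) = e (A u)

omit [CompleteSpace E] in
/-- Nonnegativity of the real part of a quadratic form may be tested on a total family. -/
theorem ContinuousLinearMap.re_inner_nonneg_of_total (A : H →L[ℂ] H) {ι : Type}
    (p : ι → E →L[ℂ] H) (hp : ∀ f, (∀ i u, ⟪p i u, f⟫_ℂ = 0) → f = 0)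
    (hA : ∀ (F : Finset ι) (u : ι → E),
      0 ≤ (⟪∑ i ∈ F, p i (u i), A (∑ i ∈ F, p i (u i))⟫_ℂ).re) (f : H) :
    0 ≤ (⟪f, A f⟫_ℂ).re := by
  have hcl : IsClosed {f : H | 0 ≤ (⟪f, A f⟫_ℂ).re} := isClosed_le continuous_const (by fun_prop)
  let W : Submodule ℂ H := ⨆ i, LinearMap.range (p i : E →ₗ[ℂ] H)
  have hW : W.topologicalClosure = ⊤ := by
    rw [Submodule.topologicalClosure_eq_top_iff, Submodule.eq_bot_iff]
    refine fun f hf => hp f fun i u => hf _ ?_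
    exact Submodule.mem_iSup_of_mem i ⟨u, rfl⟩
  have hsub : (W : Set H) ⊆ {f : H | 0 ≤ (⟪f, A f⟫_ℂ).re} := by
    intro f hf
    obtain ⟨a, ha, rfl⟩ := (Submodule.mem_iSup_iff_exists_finsupp _ _).1 hf
    choose u hu using ha
    have : a.sum (fun _ x => x) = ∑ i ∈ a.support, p i (u i) :=
      Finset.sum_congr rfl fun i _ => (hu i).symm
    rw [Set.mem_ofPred_eq, this]
    exact hA _ _
  have := closure_minimal hsub hcl
  rw [← Submodule.topologicalClosure_coe, hW] at this
  exact this (Set.mem_univ f)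

namespace IsUnilateralShift

variable {S : H →L[ℂ] H} {e : E →L[ℂ] H} (h : IsUnilateralShift S e)
include h

theorem adj_shift (f : H) : (S†) (S f) = f :=
  ext_inner_left ℂ fun v => by rw [adjoint_inner_right, h.inner_shift]

theorem adj_vac (u : E) : (e†) (e u) = u :=
  ext_inner_left ℂ fun v => by rw [adjoint_inner_right, h.inner_vac]

theorem adj_vac_shift (f : H) : (e†) (S f) = 0 :=
  ext_inner_left ℂ fun v => by rw [adjoint_inner_right, h.inner_vac_shift, inner_zero_right]

theorem adj_shift_vac (u : E) : (S†) (e u) = 0 :=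
  ext_inner_right ℂ fun v => by rw [adjoint_inner_left, h.inner_vac_shift, inner_zero_left]

theorem decomp_eq (f : H) : f = e ((e†) f) + S ((S†) f) := by
  obtain ⟨u, g, rfl⟩ := h.decomp f
  simp [h.adj_shift, h.adj_vac, h.adj_vac_shift, h.adj_shift_vac]

theorem norm_shift (f : H) : ‖S f‖ = ‖f‖ := by
  rw [norm_eq_sqrt_re_inner (𝕜 := ℂ), h.inner_shift, ← norm_eq_sqrt_re_inner]

theorem norm_vac (u : E) : ‖e u‖ = ‖u‖ := by
  rw [norm_eq_sqrt_re_inner (𝕜 := ℂ), h.inner_vac, ← norm_eq_sqrt_re_inner]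

theorem norm_shift_pow (n : ℕ) (f : H) : ‖(S ^ n) f‖ = ‖f‖ := by
  induction n generalizing f with
  | zero => simp
  | succ n ih => rw [pow_succ, mul_apply_eq_comp, ih, h.norm_shift]

theorem opNorm_vac_le : ‖e‖ ≤ 1 :=
  opNorm_le_bound _ zero_le_one fun f => by rw [h.norm_vac, one_mul]

theorem pow_shift_comm (n : ℕ) (f : H) : (S ^ n) (S f) = S ((S ^ n) f) := by
  rw [← mul_apply_eq_comp, ← mul_apply_eq_comp, ← pow_succ, ← pow_succ']

/-- The equation `O = e C + S O Φ` of the observability operator is solvable for stable `Φ`. -/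
theorem exists_observability {Φ : X →L[ℂ] X} (hΦ : Summable fun k : ℕ => ‖Φ ^ k‖)
    (C : X →L[ℂ] E) : ∃ O : X →L[ℂ] H, ∀ x, O x = e (C x) + S (O (Φ x)) := by
  -- The solution is `∑ Sᵏ e C Φᵏ`, absolutely convergent because `S` and `e` are isometric;
  -- splitting off the term `k = 0` gives the equation.
  obtain ⟨a, ha⟩ : ∃ a : ℕ → X →L[ℂ] H, ∀ k x, a k x = (S ^ k) (e (C ((Φ ^ k) x))) :=
    ⟨fun k => (S ^ k).comp (e.comp (C.comp (Φ ^ k))), fun _ _ => rfl⟩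
  have hs : Summable a := by
    refine Summable.of_norm_bounded (g := fun k => ‖C‖ * ‖Φ ^ k‖) (hΦ.mul_left _) fun k => ?_
    refine opNorm_le_bound _ (by positivity) fun x => ?_
    rw [ha, h.norm_shift_pow, h.norm_vac, mul_assoc]
    exact C.le_opNorm_of_le (le_opNorm _ _)
  have h1 : ∀ y, HasSum (fun k => a k y) ((∑' k, a k) y) := fun y =>
    (ContinuousLinearMap.apply ℂ H y).hasSum hs.hasSum
  refine ⟨∑' k, a k, fun x => ?_⟩
  have h2 : HasSum (fun k => a (k + 1) x) (S ((∑' k, a k) (Φ x))) := by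
    refine (S.hasSum (h1 (Φ x))).congr_fun fun k => ?_
    rw [ha, ha, pow_succ', pow_succ, mul_apply_eq_comp, mul_apply_eq_comp]
  have h3 := h2.unique ((hasSum_nat_add_iff' 1).2 (h1 x))
  rw [h3, Finset.sum_range_one, ha, pow_zero, pow_zero, one_apply_eq_self, one_apply_eq_self]
  abel

/-- The Toeplitz operator of a stable system, characterized by its first column and by commuting
with the shift. -/
theorem exists_toeplitz {Φ : X →L[ℂ] X} (hΦ : Summable fun k : ℕ => ‖Φ ^ k‖)
    (Γ : E →L[ℂ] X) (C : X →L[ℂ] E) (D : E →L[ℂ] E) {O : X →L[ℂ] H}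
    (hO : ∀ x, O x = e (C x) + S (O (Φ x))) :
    ∃ T : H →L[ℂ] H, (∀ u, T (e u) = e (D u) + S (O (Γ u))) ∧ ∀ f, T (S f) = S (T f) := by
  choose lift hn hS he using h.diag
  -- The operator is `diag D + S ∑ Sᵏ diag(C Φᵏ Γ)`, with diagonal extensions supplied by `diag`.
  obtain ⟨a, ha⟩ : ∃ a : ℕ → H →L[ℂ] H, ∀ k f, a k f = (S ^ k) (lift (C.comp ((Φ ^ k).comp Γ)) f) :=
    ⟨fun k => (S ^ k).comp (lift (C.comp ((Φ ^ k).comp Γ))), fun _ _ => rfl⟩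
  have hs : Summable a := by
    refine Summable.of_norm_bounded (g := fun k => ‖C‖ * (‖Φ ^ k‖ * ‖Γ‖))
      ((hΦ.mul_right _).mul_left _) fun k => ?_
    refine opNorm_le_bound _ (by positivity) fun x => ?_
    rw [ha, h.norm_shift_pow]
    refine le_of_opNorm_le _ ((hn _).trans ((opNorm_comp_le _ _).trans ?_)) x
    gcongr
    exact opNorm_comp_le _ _
  have h1 : ∀ y, HasSum (fun k => a k y) ((∑' k, a k) y) := fun y =>
    (ContinuousLinearMap.apply ℂ H y).hasSum hs.hasSum
  refine ⟨lift D + S.comp (∑' k, a k), fun u => ?_, fun f => ?_⟩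
  -- Unrolling `hO` shows that any solution `O` is the sum of its series: the remainder `S^N O Φ^N
  -- x` tends to zero.
  · have hpart : ∀ (N : ℕ) x, O x =
        ∑ k ∈ Finset.range N, (S ^ k) (e (C ((Φ ^ k) x))) + (S ^ N) (O ((Φ ^ N) x)) := by
      intro N x
      induction N with
      | zero => simp
      | succ N ih =>
        rw [ih, Finset.sum_range_succ, add_assoc, hO ((Φ ^ N) x), map_add, h.pow_shift_comm,
          pow_succ' S, pow_succ' Φ, mul_apply_eq_comp, mul_apply_eq_comp]
    have h2 : HasSum (fun k => a k (e u)) (O (Γ u)) := by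
      refine (Summable.hasSum_iff_tendsto_nat ⟨_, h1 (e u)⟩).2 ?_
      have hz : Filter.Tendsto (fun N => (S ^ N) (O ((Φ ^ N) (Γ u)))) Filter.atTop (nhds 0) := by
        refine squeeze_zero_norm (a := fun N => ‖O‖ * (‖Φ ^ N‖ * ‖Γ u‖)) (fun N => ?_) ?_
        · rw [h.norm_shift_pow]
          exact O.le_opNorm_of_le (le_opNorm _ _)
        · simpa using (hΦ.tendsto_atTop_zero.mul_const ‖Γ u‖).const_mul ‖O‖
      have := (tendsto_const_nhds (x := O (Γ u))).sub hz
      rw [sub_zero] at this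
      refine this.congr fun N => ?_
      rw [sub_eq_iff_eq_add, hpart N (Γ u)]
      simp [ha, he]
    rw [_root_.add_apply, he, ContinuousLinearMap.comp_apply, (h1 (e u)).unique h2]
  · have h2 : HasSum (fun k => a k (S f)) (S ((∑' k, a k) f)) := by
      refine (S.hasSum (h1 f)).congr_fun fun k => ?_
      rw [ha, ha, hS, h.pow_shift_comm]
    rw [_root_.add_apply, _root_.add_apply, hS, ContinuousLinearMap.comp_apply,
      ContinuousLinearMap.comp_apply, (h1 (S f)).unique h2, map_add]

section Riccati

variable {Φ : X →L[ℂ] X} {Γ : E →L[ℂ] X} {C : X →L[ℂ] E} {D : E →L[ℂ] E} {O : X →L[ℂ] H}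
  {T : H →L[ℂ] H}

/-- A Toeplitz operator with nonnegative real part yields, for every `ε > 0`, a stabilizing
solution of the Riccati equation. -/
theorem exists_riccati (hO : ∀ x, O x = e (C x) + S (O (Φ x)))
    (hTe : ∀ u, T (e u) = e (D u) + S (O (Γ u))) (hTS : ∀ f, T (S f) = S (T f))
    (hT : ∀ f, 0 ≤ (⟪f, T f⟫_ℂ).re) {ε : ℝ} (hε : 0 < ε) :
    ∃ (P : X →L[ℂ] X) (K : X →L[ℂ] E), P.IsPositive ∧
      (∀ u, ε * ‖u‖ ^ 2 ≤ (⟪u, D u + (D†) u + (ε : ℂ) • u - (Γ†) (P (Γ u))⟫_ℂ).re) ∧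
      (∀ x, D (K x) + (D†) (K x) + (ε : ℂ) • K x - (Γ†) (P (Γ (K x))) = (Γ†) (P (Φ x)) - C x) ∧
      (∀ x, P x = (Φ†) (P (Φ x)) + ((Φ†) (P (Γ (K x))) - (C†) (K x))) ∧
      ∀ (x : X) (μ : ℂ), 1 ≤ ‖μ‖ → Φ x + Γ (K x) = μ • x → K x = 0 := by
  -- `⟪f, M f⟫ + 2 Re ⟪f, O x⟫` is the energy supplied by the input `f` from the state `x`, with
  -- margin `ε`; the Riccati data come from minimizing it.
  let M : H →L[ℂ] H := T + T† + (ε : ℂ) • 1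
  have hM : ∀ f, M f = T f + (T†) f + (ε : ℂ) • f := fun f => by simp [M]
  have hMsa : ∀ f g, ⟪M f, g⟫_ℂ = ⟪f, M g⟫_ℂ := fun f g => by
    simp only [hM, inner_add_left, inner_add_right, adjoint_inner_left, adjoint_inner_right,
      inner_smul_left, inner_smul_right, Complex.conj_ofReal]
    ring
  have hMre : ∀ f, ε * ‖f‖ ^ 2 ≤ (⟪f, M f⟫_ℂ).re := fun f => by
    have h1 : (⟪f, (T†) f⟫_ℂ).re = (⟪f, T f⟫_ℂ).re := by
      rw [adjoint_inner_right, ← inner_conj_symm, Complex.conj_re]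
    have h2 : (⟪f, (ε : ℂ) • f⟫_ℂ).re = ε * ‖f‖ ^ 2 := by
      rw [inner_smul_right, inner_self_eq_norm_sq_to_K, Complex.re_ofReal_mul]
      norm_cast
    rw [hM, inner_add_right, inner_add_right, Complex.add_re, Complex.add_re, h1, h2]
    linarith [hT f]
  have hMu : IsUnit M := by
    refine isUnit_of_forall_le_norm_inner_map M (c := ⟨ε, hε.le⟩) hε fun f => ?_
    rw [hMsa]
    calc ‖f‖ ^ 2 * ε ≤ (⟪f, M f⟫_ℂ).re := by rw [mul_comm]; exact hMre f
      _ ≤ _ := Complex.re_le_norm _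
  obtain ⟨⟨M, N, hMN, hNM⟩, rfl : M = _⟩ := hMu
  replace hMN : ∀ f, M (N f) = f := fun f => by
    rw [← mul_apply_eq_comp, hMN]; rfl
  replace hNM : ∀ f, N (M f) = f := fun f => by
    rw [← mul_apply_eq_comp, hNM]; rfl
  have hinj : ∀ {f g : H}, M f = M g → f = g := fun {f g} hfg => by rw [← hNM f, hfg, hNM]
  have hTadj_e : ∀ a, (T†) (e a) = e ((D†) a) := fun a => by
    refine ext_inner_right ℂ fun v => ?_
    rw [adjoint_inner_left, h.decomp_eq v]
    simp [inner_add_right, hTe, hTS, h.inner_vac, h.inner_vac_shift, adjoint_inner_left]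
  have hTadj_S : ∀ g, (e†) ((T†) (S g)) = (Γ†) ((O†) g) := fun g => by
    refine ext_inner_left ℂ fun v => ?_
    have : ⟪e (D v), S g⟫_ℂ = 0 := h.inner_vac_shift _ _
    simp [inner_add_left, hTe, h.inner_shift, this, adjoint_inner_right]
  have hTadj_SS : ∀ g, (S†) ((T†) (S g)) = (T†) g := fun g => by
    refine ext_inner_left ℂ fun v => ?_
    simp [hTS, h.inner_shift, adjoint_inner_right]
  have heM : ∀ a g, (e†) (M (e a + S g)) = D a + (D†) a + (ε : ℂ) • a + (Γ†) ((O†) g) := by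
    intro a g
    simp only [hM, map_add, map_smul, hTe, hTS, hTadj_e, hTadj_S, h.adj_vac, h.adj_vac_shift,
      smul_zero, add_zero, smul_add]
    abel
  have hSM : ∀ a g, (S†) (M (e a + S g)) = O (Γ a) + M g := by
    intro a g
    simp only [hM, map_add, map_smul, hTe, hTS, hTadj_e, hTadj_SS, h.adj_shift, h.adj_shift_vac,
      smul_zero, zero_add, smul_add]
    abel
  have hOe : ∀ x, (e†) (O x) = C x := fun x => by
    rw [hO, map_add, h.adj_vac, h.adj_vac_shift, add_zero]
  have hOS : ∀ x, (S†) (O x) = O (Φ x) := fun x => by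
    rw [hO, map_add, h.adj_shift, h.adj_shift_vac, zero_add]
  have hOadj : ∀ a g, (O†) (e a + S g) = (C†) a + (Φ†) ((O†) g) := fun a g => by
    refine ext_inner_left ℂ fun v => ?_
    rw [adjoint_inner_right, hO]
    have : ⟪S (O (Φ v)), e a⟫_ℂ = 0 := by
      rw [← inner_conj_symm, h.inner_vac_shift, map_zero]
    simp [inner_add_left, inner_add_right, h.inner_vac, h.inner_vac_shift, h.inner_shift, this,
      adjoint_inner_right]
  -- `U x` is the optimal input from `x`, `-⟪x, P x⟫` the minimal cost, and `K x` the first sample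
  -- of the optimal input.
  obtain ⟨U, hU⟩ : ∃ U : X →L[ℂ] H, ∀ x, U x = -N (O x) := ⟨-N.comp O, fun _ => rfl⟩
  obtain ⟨P, hP⟩ : ∃ P : X →L[ℂ] X, ∀ x, P x = (O†) (N (O x)) :=
    ⟨(O†).comp (N.comp O), fun _ => rfl⟩
  obtain ⟨K, hK⟩ : ∃ K : X →L[ℂ] E, ∀ x, K x = (e†) (U x) := ⟨(e†).comp U, fun _ => rfl⟩
  have hPU : ∀ x, (O†) (U x) = -P x := fun x => by rw [hU, hP, map_neg]
  have hMU : ∀ x, M (U x) = -O x := fun x => by rw [hU, map_neg, hMN]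
  have hUd : ∀ x, U x = e (K x) + S ((S†) (U x)) := fun x => by rw [hK, ← h.decomp_eq]
  -- Bellman's principle: the tail of the optimal input is the optimal input from the next state.
  have hV : ∀ x, (S†) (U x) = U (Φ x + Γ (K x)) := fun x => by
    apply hinj
    have h1 := hSM (K x) ((S†) (U x))
    rw [← hUd, hMU, map_neg, hOS] at h1
    rw [hMU, map_add, neg_add, h1]
    abel
  refine ⟨P, K, ?_, fun u => ?_, fun x => ?_, fun x => ?_, fun x μ hμ hx => ?_⟩
  · have hPs : ∀ x y, ⟪P x, y⟫_ℂ = ⟪N (O x), M (N (O y))⟫_ℂ := fun x y => by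
      rw [hP, adjoint_inner_left, hMN]
    refine ⟨fun x y => ?_, fun x => ?_⟩
    · change ⟪P x, y⟫_ℂ = ⟪x, P y⟫_ℂ
      rw [hPs, ← inner_conj_symm x, hPs, ← hMsa, inner_conj_symm]
    · rw [reApplyInnerSelf_apply, hPs]
      exact le_trans (by positivity) (hMre _)
  -- This continuation annihilates the shifted part of `M (e u + S g)`, so the form of `M` at `e u +
  -- S g` is exactly that of the Riccati weight at `u`.
  · let g := -N (O (Γ u))
    have h1 : (S†) (M (e u + S g)) = 0 := by
      rw [hSM, map_neg, hMN, add_neg_cancel]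
    have h2 : (e†) (M (e u + S g)) = D u + (D†) u + (ε : ℂ) • u - (Γ†) (P (Γ u)) := by
      rw [heM, hP, map_neg, map_neg, sub_eq_add_neg]
    have h3 : M (e u + S g) = e (D u + (D†) u + (ε : ℂ) • u - (Γ†) (P (Γ u))) := by
      rw [← h2, h.decomp_eq (M _), h1]; simp [h.adj_vac]
    have h4 := hMre (e u + S g)
    have h0 : ∀ v, ⟪S g, e v⟫_ℂ = 0 := fun v => by
      rw [← inner_conj_symm, h.inner_vac_shift, map_zero]
    rw [h3, inner_add_left, h.inner_vac, h0, add_zero] at h4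
    refine le_trans ?_ h4
    have h5 : ‖u‖ ≤ ‖e u + S g‖ := by
      have : ‖(e†) (e u + S g)‖ ≤ 1 * ‖e u + S g‖ :=
        le_of_opNorm_le _ (by rw [LinearIsometryEquiv.norm_map]; exact h.opNorm_vac_le) _
      simpa [h.adj_vac, h.adj_vac_shift] using this
    gcongr
  · have h1 := heM (K x) ((S†) (U x))
    rw [← hUd, hMU, map_neg, hOe, hV, hPU, map_neg, map_add P, map_add] at h1
    rw [eq_comm, ← sub_eq_zero] at h1 ⊢
    rw [← neg_eq_zero, ← h1]
    abel
  · have h1 := hOadj (K x) ((S†) (U x))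
    rw [← hUd, hV, hPU, hPU, map_neg, map_add P, map_add] at h1
    rw [← neg_neg (P x), h1]
    abel
  -- By Bellman's principle `U x` is an eigenvector of `S†`. Splitting off the first sample gives
  -- `‖U x‖² = ‖K x‖² + |μ|² ‖U x‖²`, which leaves no room for `K x` when `|μ| ≥ 1`.
  · have h1 : (S†) (U x) = μ • U x := by rw [hV, hx, map_smul]
    have h2 : ‖U x‖ ^ 2 = ‖K x‖ ^ 2 + ‖μ‖ ^ 2 * ‖U x‖ ^ 2 := by
      have h3 := norm_add_sq_eq_norm_sq_add_norm_sq_of_inner_eq_zero (𝕜 := ℂ) (e (K x))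
        (S ((S†) (U x))) (h.inner_vac_shift _ _)
      rw [← hUd, h.norm_vac, h.norm_shift, h1, norm_smul] at h3
      linear_combination h3
    have h4 : ‖U x‖ ^ 2 ≤ ‖μ‖ ^ 2 * ‖U x‖ ^ 2 :=
      le_mul_of_one_le_left (by positivity) (one_le_pow₀ hμ)
    have h5 : ‖K x‖ ^ 2 = 0 := le_antisymm (by linarith) (by positivity)
    simpa using h5

end Riccati


/-! ### From a nonnegative Pick form to a Toeplitz operator with nonnegative real part. -/

section Pick

theorem summable_norm_adjoint_pow {Φ : X →L[ℂ] X} (hΦ : Summable fun k : ℕ => ‖Φ ^ k‖) :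
    Summable fun k : ℕ => ‖(Φ†) ^ k‖ := by
  refine hΦ.congr fun k => ?_
  rw [← star_eq_adjoint, ← star_pow, norm_star]

/-- The geometric sequences `u, z u, z² u, …`. -/
theorem exists_geometric {z : ℂ} (hz : ‖z‖ < 1) :
    ∃ g : E →L[ℂ] H, ∀ u, g u = e u + z • S (g u) := by
  have hs : Summable fun k : ℕ => ‖(z • (1 : E →L[ℂ] E)) ^ k‖ := by
    refine Summable.of_nonneg_of_le (fun _ => norm_nonneg _) (fun k => ?_)
      (summable_geometric_of_lt_one (norm_nonneg z) hz)
    rw [smul_pow, one_pow, norm_smul, norm_pow]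
    exact mul_le_of_le_one_right (by positivity) norm_id_le
  obtain ⟨g, hg⟩ := h.exists_observability hs 1
  exact ⟨g, fun u => by simpa using hg u⟩

section Geometric

variable {g : ℂ → E →L[ℂ] H} (hg : ∀ z : ℂ, ‖z‖ < 1 → ∀ u, g z u = e u + z • S (g z u))
include hg

theorem norm_geometric_le {z : ℂ} (hz : ‖z‖ ≤ 1 / 2) (u : E) : ‖g z u‖ ≤ 2 * ‖u‖ := by
  have h1 : ‖g z u‖ ≤ ‖u‖ + ‖z‖ * ‖g z u‖ := by
    conv_lhs => rw [hg z (by linarith)]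
    refine (norm_add_le _ _).trans_eq ?_
    rw [norm_smul, h.norm_vac, h.norm_shift]
  nlinarith [norm_nonneg (g z u)]

theorem adj_shift_geometric {z : ℂ} (hz : ‖z‖ < 1) (u : E) : (S†) (g z u) = z • g z u := by
  conv_lhs => rw [hg z hz]
  rw [map_add, map_smul, h.adj_shift, h.adj_shift_vac, zero_add]

theorem adj_vac_geometric {z : ℂ} (hz : ‖z‖ < 1) (u : E) : (e†) (g z u) = u := by
  rw [hg z hz, map_add, map_smul, h.adj_vac, h.adj_vac_shift, smul_zero, add_zero]

/-- Unrolling both sequences by one step gives a linear equation for their inner product, whose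
solution is the Szegő kernel, the denominator of the Pick form. -/
theorem inner_geometric {z w : ℂ} (hz : ‖z‖ < 1) (hw : ‖w‖ < 1) (u v : E) :
    ⟪g z u, g w v⟫_ℂ = ⟪u, v⟫_ℂ / (1 - (starRingEnd ℂ) z * w) := by
  have h1 : ‖(starRingEnd ℂ) z * w‖ < 1 := by
    rw [norm_mul, RCLike.norm_conj]
    exact mul_lt_one_of_nonneg_of_lt_one_left (norm_nonneg _) hz hw.le
  have h2 : 1 - (starRingEnd ℂ) z * w ≠ 0 := fun h0 => by
    rw [← sub_eq_zero.1 h0, norm_one] at h1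
    exact lt_irrefl _ h1
  have h0 : ⟪S (g z u), e v⟫_ℂ = 0 := by rw [← inner_conj_symm, h.inner_vac_shift, map_zero]
  have h3 : ⟪g z u, g w v⟫_ℂ = ⟪u, v⟫_ℂ + (starRingEnd ℂ) z * w * ⟪g z u, g w v⟫_ℂ := by
    conv_lhs => rw [hg z hz, hg w hw]
    rw [inner_add_left, inner_add_right, inner_add_right, inner_smul_left, inner_smul_left,
      inner_smul_right, inner_smul_right, h.inner_vac, h.inner_vac_shift, h0, h.inner_shift]
    ring
  rw [eq_div_iff h2]
  linear_combination h3

/-- The difference `d` from the geometric sequence with the same first sample satisfies `d = z • S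
d`, so `‖d‖ = |z| ‖d‖`. -/
theorem eq_geometric_of_adj_shift {z : ℂ} (hz : ‖z‖ < 1) {f : H} (hf : (S†) f = z • f) :
    f = g z ((e†) f) := by
  let d := f - g z ((e†) f)
  have h1 : (e†) d = 0 := by rw [map_sub, h.adj_vac_geometric hg hz, sub_self]
  have h2 : (S†) d = z • d := by
    rw [map_sub, h.adj_shift_geometric hg hz, hf, smul_sub]
  have h3 : ‖d‖ = ‖z‖ * ‖d‖ := by
    conv_lhs => rw [h.decomp_eq d, h1, h2, map_zero, zero_add, h.norm_shift, norm_smul]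
  have h4 : ‖d‖ = 0 := by nlinarith [norm_nonneg d]
  exact sub_eq_zero.1 (norm_eq_zero.1 h4)

/-- The point `z = 0` is excluded because the Pick form evaluates the transfer function at `z⁻¹`.
Orthogonality to the first samples is recovered by letting `z → 0`, and the property then passes
from `f` to `S† f`. -/
theorem eq_zero_of_orthogonal_geometric {f : H}
    (hf : ∀ z : ℂ, 0 < ‖z‖ → ‖z‖ < 1 → ∀ u, ⟪g z u, f⟫_ℂ = 0) : f = 0 := by
  have key : ∀ f : H, (∀ z : ℂ, 0 < ‖z‖ → ‖z‖ < 1 → ∀ u, ⟪g z u, f⟫_ℂ = 0) →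
      (∀ u, ⟪e u, f⟫_ℂ = 0) ∧
      ∀ z : ℂ, 0 < ‖z‖ → ‖z‖ < 1 → ∀ u, ⟪g z u, (S†) f⟫_ℂ = 0 := by
    intro f hf
    have h1 : ∀ z : ℂ, 0 < ‖z‖ → ‖z‖ < 1 → ∀ u,
        ⟪e u, f⟫_ℂ + (starRingEnd ℂ) z * ⟪S (g z u), f⟫_ℂ = 0 := fun z h0 hz u => by
      rw [← inner_smul_left, ← inner_add_left, ← hg z hz, hf z h0 hz]
    have h2 : ∀ u, ⟪e u, f⟫_ℂ = 0 := fun u => by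
      have hb : ∀ᶠ t : ℝ in nhdsWithin 0 (Set.Ioi 0), ‖⟪e u, f⟫_ℂ‖ ≤ t * (2 * ‖u‖ * ‖f‖) := by
        filter_upwards [Ioc_mem_nhdsGT (show (0 : ℝ) < 1 / 2 by norm_num)] with t ht
        have hn : ‖(t : ℂ)‖ = t := by rw [Complex.norm_real, Real.norm_of_nonneg ht.1.le]
        have h3 := h1 t (by rw [hn]; exact ht.1) (by rw [hn]; linarith [ht.2]) u
        rw [eq_neg_of_add_eq_zero_left h3, norm_neg, norm_mul, RCLike.norm_conj, hn]
        refine mul_le_mul_of_nonneg_left ((norm_inner_le_norm _ _).trans ?_) ht.1.le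
        rw [h.norm_shift]
        gcongr
        exact h.norm_geometric_le hg (by rw [hn]; exact ht.2) u
      have ht : Filter.Tendsto (fun t : ℝ => t * (2 * ‖u‖ * ‖f‖)) (nhdsWithin 0 (Set.Ioi 0))
          (nhds 0) := by
        have : Continuous fun t : ℝ => t * (2 * ‖u‖ * ‖f‖) := by fun_prop
        simpa using (this.tendsto 0).mono_left nhdsWithin_le_nhds
      exact norm_le_zero_iff.1 (ge_of_tendsto ht hb)
    refine ⟨h2, fun z h0 hz u => ?_⟩
    have h3 := h1 z h0 hz u
    rw [h2, zero_add, mul_eq_zero] at h3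
    rw [adjoint_inner_right]
    exact h3.resolve_left fun h4 => by simp [(map_eq_zero _).1 h4] at h0
  refine h.eq_zero f fun n u => ?_
  induction n generalizing f with
  | zero => exact (key f hf).1 u
  | succ n ih =>
    rw [pow_succ', mul_apply_eq_comp, ← adjoint_inner_right]
    exact ih (key f hf).2

end Geometric

variable {Φ : X →L[ℂ] X} {Γ : E →L[ℂ] X} {C : X →L[ℂ] E} {D : E →L[ℂ] E} {O : X →L[ℂ] H}
  {T : H →L[ℂ] H}

theorem inner_shift_pow_observability (hO : ∀ x, O x = e (C x) + S (O (Φ x))) (i : ℕ) (v : E)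
    (x : X) : ⟪(S ^ i) (e v), O x⟫_ℂ = ⟪v, C ((Φ ^ i) x)⟫_ℂ := by
  induction i generalizing x with
  | zero => rw [hO, pow_zero, pow_zero, inner_add_right]; simp [h.inner_vac, h.inner_vac_shift]
  | succ i ih =>
    have : ⟪S ((S ^ i) (e v)), e (C x)⟫_ℂ = 0 := by
      rw [← inner_conj_symm, h.inner_vac_shift, map_zero]
    rw [hO, pow_succ', pow_succ, mul_apply_eq_comp, mul_apply_eq_comp, inner_add_right, this,
      h.inner_shift, zero_add, ih]

theorem inner_shift_pow_succ_vac (i : ℕ) (f : H) (w : E) : ⟪(S ^ (i + 1)) f, e w⟫_ℂ = 0 := by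
  rw [← inner_conj_symm, pow_succ', mul_apply_eq_comp, h.inner_vac_shift, map_zero]

theorem inner_shift_pow (n : ℕ) (f f' : H) : ⟪(S ^ n) f, (S ^ n) f'⟫_ℂ = ⟪f, f'⟫_ℂ := by
  induction n with
  | zero => simp
  | succ n ih => rw [pow_succ', mul_apply_eq_comp, mul_apply_eq_comp, h.inner_shift, ih]

/-- The block entries of a Toeplitz operator. -/
theorem inner_toeplitz (hO : ∀ x, O x = e (C x) + S (O (Φ x)))
    (hTe : ∀ u, T (e u) = e (D u) + S (O (Γ u))) (hTS : ∀ f, T (S f) = S (T f))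
    (j k : ℕ) (v w : E) :
    ⟪(S ^ j) (e v), T ((S ^ k) (e w))⟫_ℂ =
      if j < k then 0 else if j = k then ⟪v, D w⟫_ℂ else ⟪v, C ((Φ ^ (j - k - 1)) (Γ w))⟫_ℂ := by
  have hTSn : ∀ (n : ℕ) f, T ((S ^ n) f) = (S ^ n) (T f) := fun n f => by
    induction n with
    | zero => simp
    | succ n ih => rw [pow_succ', mul_apply_eq_comp, hTS, ih, mul_apply_eq_comp]
  rw [hTSn]
  rcases lt_trichotomy j k with hjk | rfl | hjk
  · obtain ⟨i, rfl⟩ := Nat.exists_eq_add_of_lt hjk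
    rw [if_pos hjk, add_assoc, pow_add, mul_apply_eq_comp, h.inner_shift_pow, pow_succ',
      mul_apply_eq_comp, h.inner_vac_shift]
  · rw [if_neg (lt_irrefl _), if_pos rfl, h.inner_shift_pow, hTe, inner_add_right, h.inner_vac,
      h.inner_vac_shift, add_zero]
  · obtain ⟨i, rfl⟩ := Nat.exists_eq_add_of_lt hjk
    rw [if_neg (by omega), if_neg (by omega), add_assoc, pow_add, mul_apply_eq_comp,
      h.inner_shift_pow, hTe, inner_add_right, h.inner_shift_pow_succ_vac, zero_add, pow_succ',
      mul_apply_eq_comp, h.inner_shift, h.inner_shift_pow_observability hO]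
    congr 5
    omega

/-- Positivity of the Pick form makes the real part of the Toeplitz operator nonnegative. -/
theorem toeplitz_re_nonneg (hΦ : Summable fun k : ℕ => ‖Φ ^ k‖)
    (hO : ∀ x, O x = e (C x) + S (O (Φ x)))
    (hTe : ∀ u, T (e u) = e (D u) + S (O (Γ u))) (hTS : ∀ f, T (S f) = S (T f))
    (hPick : ∀ (F : Finset {z : ℂ // 0 < ‖z‖ ∧ ‖z‖ < 1}) (u : {z : ℂ // 0 < ‖z‖ ∧ ‖z‖ < 1} → E)
      (x : {z : ℂ // 0 < ‖z‖ ∧ ‖z‖ < 1} → X),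
      (∀ z, x z = (z : ℂ) • (Φ (x z) + Γ (u z))) →
      0 ≤ (∑ z ∈ F, ∑ w ∈ F, ⟪u z, D (u w) + C (x w)⟫_ℂ /
        (1 - (starRingEnd ℂ) (z : ℂ) * w)).re) (f : H) :
    0 ≤ (⟪f, T f⟫_ℂ).re := by
  -- The Toeplitz operator `T'` of the dual system has an upper triangular adjoint with the same
  -- blocks as `T`. Geometric sequences suit `T'†`, whereas they do not suit `T` itself.
  obtain ⟨O', hO'⟩ := h.exists_observability (h.summable_norm_adjoint_pow hΦ) (Γ†)
  obtain ⟨T', hTe', hTS'⟩ := h.exists_toeplitz (h.summable_norm_adjoint_pow hΦ) (C†) (Γ†) (D†) hO'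
  choose g hg using fun z : {z : ℂ // ‖z‖ < 1} => h.exists_geometric z.2
  let G : ℂ → E →L[ℂ] H := fun z => if hz : ‖z‖ < 1 then g ⟨z, hz⟩ else 0
  have hG : ∀ z : ℂ, ‖z‖ < 1 → ∀ u, G z u = e u + z • S (G z u) := fun z hz u => by
    simpa [G, hz] using hg ⟨z, hz⟩ u
  have h1 : ∀ f, 0 ≤ (⟪f, (T'†) f⟫_ℂ).re := by
    refine re_inner_nonneg_of_total (T'†) (fun z : {z : ℂ // 0 < ‖z‖ ∧ ‖z‖ < 1} => G z)
      (fun f hf => h.eq_zero_of_orthogonal_geometric hG fun z h0 hz u => hf ⟨z, h0, hz⟩ u)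
      fun F u => ?_
    let x : {z : ℂ // 0 < ‖z‖ ∧ ‖z‖ < 1} → X := fun z => (z : ℂ) • (O'†) (G z (u z))
    have hOadj : ∀ f, (O'†) f = Γ ((e†) f) + Φ ((O'†) ((S†) f)) := fun f => by
      refine ext_inner_left ℂ fun v => ?_
      rw [adjoint_inner_right, hO', inner_add_left, inner_add_right, ← adjoint_inner_right,
        ← adjoint_inner_right S, ← adjoint_inner_right O', adjoint_inner_left, adjoint_inner_left]
    have hx : ∀ z, x z = (z : ℂ) • (Φ (x z) + Γ (u z)) := fun z => by
      simp only [x]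
      conv_lhs => rw [hOadj]
      rw [h.adj_vac_geometric hG z.2.2, h.adj_shift_geometric hG z.2.2, map_smul, add_comm]
    -- `T'†` commutes with `S†` and so preserves its eigenspace at `z`, the geometric sequences; on
    -- their coefficients it acts as the transfer function at `z⁻¹`.
    have hT' : ∀ z : {z : ℂ // 0 < ‖z‖ ∧ ‖z‖ < 1}, (T'†) (G z (u z)) = G z (D (u z) + C (x z)) := by
      intro z
      have hs : ∀ f, (S†) ((T'†) f) = (T'†) ((S†) f) := fun f => by
        refine ext_inner_left ℂ fun v => ?_
        simp only [adjoint_inner_right, hTS']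
      have hz : (S†) ((T'†) (G z (u z))) = (z : ℂ) • (T'†) (G z (u z)) := by
        rw [hs, h.adj_shift_geometric hG z.2.2, map_smul]
      rw [h.eq_geometric_of_adj_shift hG z.2.2 hz]
      congr 1
      refine ext_inner_left ℂ fun v => ?_
      rw [adjoint_inner_right, adjoint_inner_right, hTe', inner_add_left, inner_add_right,
        ← adjoint_inner_right, ← adjoint_inner_right S, ← adjoint_inner_right O',
        adjoint_inner_left, adjoint_inner_left, h.adj_vac_geometric hG z.2.2,
        h.adj_shift_geometric hG z.2.2, map_smul]
    refine (hPick F u x hx).trans_eq ?_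
    rw [map_sum, sum_inner]
    congr 1
    refine Finset.sum_congr rfl fun z _ => ?_
    rw [inner_sum]
    refine Finset.sum_congr rfl fun w _ => ?_
    rw [hT', h.inner_geometric hG z.2.2 w.2.2]
  -- Reversing the order of the `N` samples turns the finite section of `T'†` into that of `T`.
  have hN : ∀ (N : ℕ) (v : ℕ → E), 0 ≤ (⟪∑ j ∈ Finset.range N, (S ^ j) (e (v j)),
      T (∑ j ∈ Finset.range N, (S ^ j) (e (v j)))⟫_ℂ).re := by
    intro N v
    refine (h1 (∑ j ∈ Finset.range N, (S ^ j) (e (v (N - 1 - j))))).trans_eq ?_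
    congr 1
    simp only [map_sum, sum_inner, inner_sum]
    rw [← Finset.sum_range_reflect]
    refine Finset.sum_congr rfl fun j hj => ?_
    rw [← Finset.sum_range_reflect]
    refine Finset.sum_congr rfl fun k hk => ?_
    rw [Finset.mem_range] at hj hk
    rw [adjoint_inner_right, ← inner_conj_symm, h.inner_toeplitz hO' hTe' hTS',
      h.inner_toeplitz hO hTe hTS, show N - 1 - (N - 1 - j) = j by omega,
      show N - 1 - (N - 1 - k) = k by omega]
    rcases lt_trichotomy k j with hjk | rfl | hjk
    · rw [if_pos (by omega), if_pos (by omega), map_zero]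
    · rw [if_neg (by omega), if_pos rfl, if_neg (by omega), if_pos rfl, inner_conj_symm,
        adjoint_inner_left]
    · rw [if_neg (by omega), if_neg (by omega), if_neg (by omega), if_neg (by omega),
        inner_conj_symm, adjoint_inner_left, ← star_eq_adjoint Φ, ← star_pow, star_eq_adjoint,
        adjoint_inner_left, adjoint_inner_left,
        show N - 1 - j - (N - 1 - k) - 1 = k - j - 1 by omega]
  refine re_inner_nonneg_of_total T (fun n : ℕ => (S ^ n).comp e) (fun f hf => h.eq_zero f hf) (fun F u => ?_) f
  classical
  have hF : F ⊆ Finset.range (F.sup id + 1) := fun i hi =>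
    Finset.mem_range.2 (Nat.lt_succ_of_le (Finset.le_sup (f := id) hi))
  have := hN (F.sup id + 1) fun i => if i ∈ F then u i else 0
  have hsum : ∑ j ∈ Finset.range (F.sup id + 1), (S ^ j) (e (if j ∈ F then u j else 0)) =
      ∑ i ∈ F, ((S ^ i).comp e) (u i) := by
    rw [← Finset.sum_subset hF fun i _ hi => by simp [hi]]
    exact Finset.sum_congr rfl fun i hi => by simp [hi]
  rwa [hsum] at this

end Pick

end IsUnilateralShift

end UnilateralShift

/-! ### The model of the shift on square-summable sequences. -/

section SequenceSpace

open scoped InnerProduct InnerProductSpace lp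

variable (E : Type) [NormedAddCommGroup E] [InnerProductSpace ℂ E]

set_option linter.unusedSectionVars false

/-- The sequence `0, f 0, f 1, …`. -/
def consZero (f : ℕ → E) : ℕ → E
  | 0 => 0
  | n + 1 => f n

theorem memℓp_two_cons {f : ℕ → E} (hf : Memℓp f 2) : Memℓp (consZero E f) 2 := by
  have hp : 0 < (2 : ENNReal).toReal := by norm_num
  refine (memℓp_gen_iff hp).2 ((summable_nat_add_iff 1).1 ?_)
  exact (memℓp_gen_iff hp).1 hf

theorem memℓp_two_tail {f : ℕ → E} (hf : Memℓp f 2) : Memℓp (fun n : ℕ => f (n + 1)) 2 := by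
  have hp : 0 < (2 : ENNReal).toReal := by norm_num
  refine (memℓp_gen_iff hp).2 ?_
  exact (summable_nat_add_iff 1).2 ((memℓp_gen_iff hp).1 hf)

/-- The right shift of square-summable sequences. -/
noncomputable def seqShift : lp (fun _ : ℕ => E) 2 →ₗᵢ[ℂ] lp (fun _ : ℕ => E) 2 where
  toFun f := ⟨consZero E f, memℓp_two_cons E (lp.memℓp f)⟩
  map_add' f g := by
    ext n
    cases n with
    | zero => exact (add_zero (0 : E)).symm
    | succ n => rfl
  map_smul' c f := by
    ext n
    cases n with
    | zero => exact (smul_zero c).symm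
    | succ n => rfl
  norm_map' f := by
    have hp : 0 < (2 : ENNReal).toReal := by norm_num
    have key : ∀ f : lp (fun _ : ℕ => E) 2, ‖f‖ ^ (2 : ENNReal).toReal =
        ∑' n, ‖f n‖ ^ (2 : ENNReal).toReal := fun f => lp.norm_rpow_eq_tsum hp f
    refine (Real.rpow_left_inj (norm_nonneg _) (norm_nonneg _) hp.ne').1 ?_
    rw [key, key, Summable.tsum_eq_zero_add (((memℓp_gen_iff hp).1 (lp.memℓp _)))]
    change ‖(0 : E)‖ ^ (2 : ENNReal).toReal + ∑' n, ‖f n‖ ^ (2 : ENNReal).toReal = _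
    rw [norm_zero, Real.zero_rpow hp.ne', zero_add]

theorem seqShift_zero (f : lp (fun _ : ℕ => E) 2) : seqShift E f 0 = 0 := rfl

theorem seqShift_succ (f : lp (fun _ : ℕ => E) 2) (n : ℕ) : seqShift E f (n + 1) = f n := rfl

theorem seqShift_single (n : ℕ) (u : E) :
    seqShift E (lp.single 2 n u) = lp.single 2 (n + 1) u := by
  ext k
  cases k with
  | zero => rw [seqShift_zero, lp.single_apply_ne _ _ _ (by omega)]
  | succ k =>
    rw [seqShift_succ]
    by_cases hk : k = n
    · subst hk; rw [lp.single_apply_self, lp.single_apply_self]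
    · rw [lp.single_apply_ne _ _ _ hk, lp.single_apply_ne _ _ _ (by omega)]

theorem exists_diag (A : E →L[ℂ] E) : ∃ A' : lp (fun _ : ℕ => E) 2 →L[ℂ] lp (fun _ : ℕ => E) 2,
    ‖A'‖ ≤ ‖A‖ ∧ ∀ f n, A' f n = A (f n) := by
  have hp : 0 < (2 : ENNReal).toReal := by norm_num
  have hb : ∀ (f : lp (fun _ : ℕ => E) 2) (n : ℕ), ‖A (f n)‖ ^ (2 : ENNReal).toReal ≤
      ‖A‖ ^ (2 : ENNReal).toReal * ‖f n‖ ^ (2 : ENNReal).toReal := fun f n => by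
    rw [← Real.mul_rpow (norm_nonneg _) (norm_nonneg _)]
    exact Real.rpow_le_rpow (norm_nonneg _) (A.le_opNorm _) hp.le
  have hs : ∀ f : lp (fun _ : ℕ => E) 2, Summable fun n => ‖f n‖ ^ (2 : ENNReal).toReal :=
    fun f => (memℓp_gen_iff hp).1 (lp.memℓp f)
  have hm : ∀ f : lp (fun _ : ℕ => E) 2, Memℓp (fun n => A (f n)) 2 := fun f =>
    memℓp_gen <| Summable.of_nonneg_of_le (fun n => by positivity) (hb f) ((hs f).mul_left _)
  let A₀ : lp (fun _ : ℕ => E) 2 →ₗ[ℂ] lp (fun _ : ℕ => E) 2 :=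
    { toFun := fun f => ⟨fun n => A (f n), hm f⟩
      map_add' := fun f g => by ext n; exact map_add A _ _
      map_smul' := fun c f => by ext n; exact map_smul A _ _ }
  refine ⟨A₀.mkContinuous ‖A‖ fun f => ?_, A₀.mkContinuous_norm_le (norm_nonneg _) _,
    fun f n => rfl⟩
  refine lp.norm_le_of_tsum_le hp (by positivity) ?_
  rw [Real.mul_rpow (norm_nonneg _) (norm_nonneg _), lp.norm_rpow_eq_tsum hp f, ← tsum_mul_left]
  exact Summable.tsum_le_tsum (hb f) ((memℓp_gen_iff hp).1 (hm f)) ((hs f).mul_left _)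

/-- The right shift of square-summable sequences is a unilateral shift. -/
theorem isUnilateralShift_seqShift : IsUnilateralShift (seqShift E).toContinuousLinearMap
    (lp.singleContinuousLinearMap ℂ (fun _ : ℕ => E) 2 0) where
  inner_shift f g := (seqShift E).inner_map_map f g
  inner_vac u v := by
    rw [lp.singleContinuousLinearMap_apply, lp.singleContinuousLinearMap_apply,
      lp.inner_single_left, lp.single_apply_self]
  inner_vac_shift u f := by
    rw [lp.singleContinuousLinearMap_apply, lp.inner_single_left]
    exact inner_zero_right _
  decomp f := by
    refine ⟨f 0, ⟨fun n => f (n + 1), memℓp_two_tail E (lp.memℓp f)⟩, ?_⟩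
    ext n
    rw [lp.singleContinuousLinearMap_apply, lp.coeFn_add, Pi.add_apply]
    cases n with
    | zero => rw [lp.single_apply_self]; exact (add_zero _).symm
    | succ n => rw [lp.single_apply_ne _ _ _ (by omega)]; exact (zero_add _).symm
  eq_zero f hf := by
    have hn : ∀ (n : ℕ) (u : E), ((seqShift E).toContinuousLinearMap ^ n)
        (lp.singleContinuousLinearMap ℂ (fun _ : ℕ => E) 2 0 u) = lp.single 2 n u := by
      intro n u
      induction n with
      | zero => rfl
      | succ n ih =>
        rw [pow_succ', mul_apply_eq_comp, ih]
        exact seqShift_single E n u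
    ext n
    have := hf n (f n)
    rw [hn, lp.inner_single_left, inner_self_eq_zero] at this
    exact this
  diag A := by
    obtain ⟨A', hA, hA'⟩ := exists_diag E A
    refine ⟨A', hA, fun f => ?_, fun u => ?_⟩
    · ext n
      cases n with
      | zero => rw [hA']; exact map_zero A
      | succ n => rw [hA']; exact (hA' f n).symm
    · ext n
      rw [hA', lp.singleContinuousLinearMap_apply, lp.singleContinuousLinearMap_apply]
      cases n with
      | zero => rw [lp.single_apply_self, lp.single_apply_self]
      | succ n =>
        rw [lp.single_apply_ne _ _ _ (by omega), lp.single_apply_ne _ _ _ (by omega), map_zero]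

open ContinuousLinearMap in
/-- A stable system whose Pick form is nonnegative has, for every `ε > 0`, a stabilizing solution
of the Riccati equation. -/
theorem exists_riccati_of_pick {E X : Type} [NormedAddCommGroup E] [InnerProductSpace ℂ E]
    [CompleteSpace E] [NormedAddCommGroup X] [InnerProductSpace ℂ X] [CompleteSpace X]
    {Φ : X →L[ℂ] X} (hΦ : Summable fun k : ℕ => ‖Φ ^ k‖) (Γ : E →L[ℂ] X) (C : X →L[ℂ] E)
    (D : E →L[ℂ] E)
    (hPick : ∀ (F : Finset {z : ℂ // 0 < ‖z‖ ∧ ‖z‖ < 1}) (u : {z : ℂ // 0 < ‖z‖ ∧ ‖z‖ < 1} → E)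
      (x : {z : ℂ // 0 < ‖z‖ ∧ ‖z‖ < 1} → X),
      (∀ z, x z = (z : ℂ) • (Φ (x z) + Γ (u z))) →
      0 ≤ (∑ z ∈ F, ∑ w ∈ F, ⟪u z, D (u w) + C (x w)⟫_ℂ /
        (1 - (starRingEnd ℂ) (z : ℂ) * w)).re) {ε : ℝ} (hε : 0 < ε) :
    ∃ (P : X →L[ℂ] X) (K : X →L[ℂ] E), P.IsPositive ∧
      (∀ u, ε * ‖u‖ ^ 2 ≤ (⟪u, D u + (D†) u + (ε : ℂ) • u - (Γ†) (P (Γ u))⟫_ℂ).re) ∧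
      (∀ x, D (K x) + (D†) (K x) + (ε : ℂ) • K x - (Γ†) (P (Γ (K x))) = (Γ†) (P (Φ x)) - C x) ∧
      (∀ x, P x = (Φ†) (P (Φ x)) + ((Φ†) (P (Γ (K x))) - (C†) (K x))) ∧
      ∀ (x : X) (μ : ℂ), 1 ≤ ‖μ‖ → Φ x + Γ (K x) = μ • x → K x = 0 := by
  have h := isUnilateralShift_seqShift E
  obtain ⟨O, hO⟩ := h.exists_observability hΦ C
  obtain ⟨T, hTe, hTS⟩ := h.exists_toeplitz hΦ Γ C D hO
  exact h.exists_riccati hO hTe hTS (h.toeplitz_re_nonneg hΦ hO hTe hTS hPick) hε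

end SequenceSpace

/-! ### Controllability and observability of minimal realizations. -/

section Minimality

theorem Matrix.notMem_spectrum_iff {ι : Type} [Fintype ι] [DecidableEq ι] {A : Matrix ι ι ℂ}
    {s : ℂ} : s ∉ spectrum ℂ A ↔ IsUnit (s • (1 : Matrix ι ι ℂ) - A) := by
  rw [spectrum.notMem_iff, Algebra.algebraMap_eq_smul_one]

theorem Matrix.transpose_smul_one_sub {ι : Type} [DecidableEq ι] (A : Matrix ι ι ℂ) (s : ℂ) :
    (s • (1 : Matrix ι ι ℂ) - A)ᵀ = s • (1 : Matrix ι ι ℂ) - Aᵀ := by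
  rw [transpose_sub, transpose_smul, transpose_one]

namespace Realization

variable {n : ℕ} {m p : Type}

/-- The dual realization. -/
def transpose (G : Realization (Fin n) m p) : Realization (Fin n) p m :=
  ⟨G.Aᵀ, G.Cᵀ, G.Bᵀ, G.Dᵀ⟩

theorem transfer_transpose (G : Realization (Fin n) m p) (s : ℂ) :
    G.transpose.transfer s = (G.transfer s)ᵀ := by
  simp only [transfer, transpose, transpose_add, transpose_mul, transpose_nonsing_inv,
    transpose_smul_one_sub, Matrix.mul_assoc]

theorem spectrum_transpose (G : Realization (Fin n) m p) :
    spectrum ℂ G.transpose.A = spectrum ℂ G.A := by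
  ext s
  rw [← not_iff_not, notMem_spectrum_iff, notMem_spectrum_iff, transpose,
    ← transpose_smul_one_sub, isUnit_transpose]

theorem IsMinimal.transpose {G : Realization (Fin n) m p} (hG : G.IsMinimal) :
    G.transpose.IsMinimal := by
  intro k G' h
  refine hG k G'.transpose fun s hs hs' => ?_
  rw [transfer_transpose, h s (by rwa [spectrum_transpose]) (by rwa [spectrum_transpose] at hs'),
    transfer_transpose, transpose_transpose]

/-- Controllability of a minimal realization. -/
theorem IsMinimal.eq_top {G : Realization (Fin n) m p} (hG : G.IsMinimal)
    (V : Submodule ℂ (Fin n → ℂ)) (hA : ∀ v ∈ V, G.A *ᵥ v ∈ V)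
    (hB : ∀ j, (fun i => G.B i j) ∈ V) : V = ⊤ := by
  -- Restricting the state space to the invariant subspace `V` keeps the transfer function and has
  -- dimension `finrank V`, so minimality forces `V` to be everything.
  let b := Module.finBasis ℂ V
  let E : Matrix (Fin n) (Fin (Module.finrank ℂ V)) ℂ := of fun i j => (b j : Fin n → ℂ) i
  let A' : Matrix (Fin (Module.finrank ℂ V)) (Fin (Module.finrank ℂ V)) ℂ :=
    of fun i j => b.repr ⟨G.A *ᵥ b j, hA _ (b j).2⟩ i
  let B' : Matrix (Fin (Module.finrank ℂ V)) m ℂ := of fun i j => b.repr ⟨_, hB j⟩ i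
  have hE : ∀ (v : V) (i : Fin n), ∑ j, E i j * b.repr v j = (v : Fin n → ℂ) i := fun v i => by
    have := congrArg (fun w : V => (w : Fin n → ℂ) i) (b.sum_repr v)
    simp only [Submodule.coe_sum, Submodule.coe_smul, Finset.sum_apply, Pi.smul_apply,
      smul_eq_mul] at this
    exact (Finset.sum_congr rfl fun j _ => mul_comm _ _).trans this
  have hEA : G.A * E = E * A' := by
    ext i j
    rw [Matrix.mul_apply, Matrix.mul_apply]
    exact (hE ⟨G.A *ᵥ b j, hA _ (b j).2⟩ i).symm
  have hEB : E * B' = G.B := by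
    ext i j
    rw [Matrix.mul_apply]
    exact hE ⟨_, hB j⟩ i
  have hn := hG _ ⟨A', B', G.C * E, G.D⟩ fun s hs hs' => by
    rw [notMem_spectrum_iff] at hs hs'
    have h1 : (s • (1 : Matrix (Fin n) (Fin n) ℂ) - G.A)⁻¹ * E = E * (s • 1 - A')⁻¹ := by
      have h2 : (s • (1 : Matrix (Fin n) (Fin n) ℂ) - G.A) * E = E * (s • 1 - A') := by
        rw [Matrix.sub_mul, Matrix.mul_sub, hEA]; simp
      have h3 := (isUnit_iff_isUnit_det _).1 hs
      have h4 := (isUnit_iff_isUnit_det _).1 hs'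
      calc _ = (s • (1 : Matrix (Fin n) (Fin n) ℂ) - G.A)⁻¹ * (E * (s • 1 - A')) *
            (s • 1 - A')⁻¹ := by
            rw [Matrix.mul_assoc, Matrix.mul_assoc, mul_nonsing_inv _ h4, Matrix.mul_one]
        _ = _ := by rw [← h2, ← Matrix.mul_assoc, nonsing_inv_mul _ h3, Matrix.one_mul]
    change G.C * E * (s • 1 - A')⁻¹ * B' + G.D = _
    rw [Matrix.mul_assoc G.C, ← h1, Matrix.mul_assoc, Matrix.mul_assoc, hEB, transfer,
      Matrix.mul_assoc]
  apply Submodule.eq_top_of_finrank_eq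
  rw [Module.finrank_fin_fun]
  exact le_antisymm (by simpa using Submodule.finrank_le V) hn

/-- Observability of a minimal realization. -/
theorem IsMinimal.eq_zero_of_mulVec_eq_zero {G : Realization (Fin n) m p} (hG : G.IsMinimal)
    {x : Fin n → ℂ} {μ : ℂ} (hx : G.A *ᵥ x = μ • x) (hC : G.C *ᵥ x = 0) : x = 0 := by
  -- The annihilator of `x` is invariant under `Aᵀ` and contains the rows of `C`, so controllability
  -- of the dual realization applies to it.
  let V : Submodule ℂ (Fin n → ℂ) :=
    { carrier := {v | v ⬝ᵥ x = 0}
      add_mem' := fun {a b} ha hb => by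
        rw [Set.mem_ofPred_eq] at *
        rw [add_dotProduct, ha, hb, add_zero]
      zero_mem' := zero_dotProduct x
      smul_mem' := fun c v hv => by
        rw [Set.mem_ofPred_eq] at *
        rw [smul_dotProduct, hv, smul_zero] }
  have hV : V = ⊤ := by
    refine hG.transpose.eq_top V (fun v hv => ?_) fun j => ?_
    · change (G.Aᵀ *ᵥ v) ⬝ᵥ x = 0
      rw [mulVec_transpose, ← dotProduct_mulVec, hx, dotProduct_smul, show v ⬝ᵥ x = 0 from hv,
        smul_zero]
    · exact congrFun hC j
  ext i
  have : Pi.single i 1 ∈ V := hV ▸ Submodule.mem_top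
  simpa using show Pi.single i 1 ⬝ᵥ x = 0 from this

end Realization

end Minimality

/-! ### Impulse responses and their convolution with square-integrable inputs. -/

theorem memLp_indicator_exp {s : ℂ} (hs : 0 < s.re) :
    MemLp (Set.indicator (Set.Iic 0) fun σ : ℝ => Complex.exp (s * σ)) 2 volume := by
  refine (memLp_indicator_iff_restrict measurableSet_Iic).2 ?_
  have hc : Continuous fun σ : ℝ => Complex.exp (s * σ) := by fun_prop
  refine (memLp_two_iff_integrable_sq_norm hc.aestronglyMeasurable).2 ?_
  have h1 := integrableOn_exp_mul_Iic (a := 2 * s.re) (by linarith) 0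
  refine h1.congr (Filter.Eventually.of_forall fun σ => ?_)
  simp only [Complex.norm_exp, ← Real.exp_nat_mul, Complex.re_mul_ofReal]
  push_cast
  ring_nf

section ImpulseResponse

variable {n p : ℕ} (A : Matrix (Fin n) (Fin n) ℂ) (C : Matrix (Fin p) (Fin n) ℂ)

section

attribute [local instance] Matrix.linftyOpNormedRing Matrix.linftyOpNormedAlgebra
  Matrix.linftyOpNormedAddCommGroup Matrix.linftyOpNormedSpace

theorem Matrix.hasDerivAt_exp_mulVec (x : Fin n → ℂ) (t : ℝ) :
    HasDerivAt (fun r : ℝ => (C * NormedSpace.exp ((r : ℂ) • A)) *ᵥ x)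
      ((C * NormedSpace.exp ((t : ℂ) • A)) *ᵥ (A *ᵥ x)) t := by
  have h1 : HasDerivAt (fun r : ℝ => NormedSpace.exp ((r : ℂ) • A))
      (NormedSpace.exp ((t : ℂ) • A) * A) t := by
    have := (hasDerivAt_exp_smul_const (𝕂 := ℂ) A (t : ℂ)).scomp t Complex.ofRealCLM.hasDerivAt
    simp only [Complex.ofRealCLM_apply, Complex.ofReal_one, one_smul] at this
    exact this
  let ℓ : Matrix (Fin n) (Fin n) ℂ →ₗ[ℝ] (Fin p → ℂ) :=
    { toFun := fun M => (C * M) *ᵥ x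
      map_add' := fun M N => by rw [Matrix.mul_add, add_mulVec]
      map_smul' := fun c M => by rw [Matrix.mul_smul, smul_mulVec]; rfl }
  have h2 := (LinearMap.toContinuousLinearMap ℓ).hasFDerivAt.comp_hasDerivAt t h1
  refine h2.congr_deriv ?_
  change (C * (NormedSpace.exp ((t : ℂ) • A) * A)) *ᵥ x = _
  rw [mulVec_mulVec, Matrix.mul_assoc]

end

theorem Matrix.exp_mulVec_eigenvector {x : Fin n → ℂ} {μ : ℂ} (hx : A *ᵥ x = μ • x) (r : ℝ) :
    (C * NormedSpace.exp ((r : ℂ) • A)) *ᵥ x = Complex.exp (r * μ) • (C *ᵥ x) := by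
  have h1 : ∀ t : ℝ, HasDerivAt (fun t : ℝ => Complex.exp (-(t * μ)) •
      ((C * NormedSpace.exp ((t : ℂ) • A)) *ᵥ x)) 0 t := fun t => by
    have h2 : HasDerivAt (fun t : ℝ => Complex.exp (-(t * μ)))
        (Complex.exp (-(t * μ)) * (-(1 * μ))) t :=
      (((hasDerivAt_id t).ofReal_comp.mul_const μ).neg).cexp
    refine (h2.smul (hasDerivAt_exp_mulVec A C x t)).congr_deriv ?_
    rw [hx, mulVec_smul, smul_smul, ← add_smul]
    simp
  have h3 := is_const_of_deriv_eq_zero (fun t => (h1 t).differentiableAt) (fun t => (h1 t).deriv)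
    r 0
  simp only [Complex.ofReal_zero, zero_mul, neg_zero, Complex.exp_zero, zero_smul,
    NormedSpace.exp_zero, Matrix.mul_one, one_smul] at h3
  rw [← h3, smul_smul, ← Complex.exp_add, add_neg_cancel, Complex.exp_zero, one_smul]

/-- The initial directions whose impulse response may be convolved with every square-integrable
scalar input. -/
def convolvable : Submodule ℂ (Fin n → ℂ) where
  carrier := {x | ∀ f : ℝ → ℂ, MemLp f 2 volume → ∀ t : ℝ, IntegrableOn
    (fun σ : ℝ => f σ • ((C * NormedSpace.exp (((t - σ : ℝ) : ℂ) • A)) *ᵥ x)) (Set.Iic t) volume}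
  add_mem' {x y} hx hy f hf t := by
    simp only [mulVec_add, smul_add]
    exact (hx f hf t).add (hy f hf t)
  zero_mem' f hf t := by simp
  smul_mem' c x hx f hf t := by
    simp only [mulVec_smul, smul_comm _ c]
    exact (hx f hf t).smul c

/-- Delaying the evaluation time shows that `e^{hA} x` is convolvable for `h ≥ 0`. Then `A x` is the
derivative at `h = 0⁺`, a limit inside a finite-dimensional, hence closed, subspace. -/
theorem mulVec_mem_convolvable {x : Fin n → ℂ} (hx : x ∈ convolvable A C) :
    A *ᵥ x ∈ convolvable A C := by
  have hexp : ∀ h : ℝ, 0 ≤ h →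
      ((1 : Matrix (Fin n) (Fin n) ℂ) * NormedSpace.exp ((h : ℂ) • A)) *ᵥ x ∈ convolvable A C := by
    intro h hh f hf t
    refine ((hx f hf (t + h)).mono_set (Set.Iic_subset_Iic.2 (by linarith))).congr_fun
      (fun σ _ => ?_) measurableSet_Iic
    simp only
    rw [Matrix.one_mul, mulVec_mulVec, Matrix.mul_assoc, ← Matrix.exp_add_of_commute _ _
      ((Commute.refl A).smul_left _ |>.smul_right _), ← add_smul]
    congr 5
    push_cast
    ring
  have hd := hasDerivAt_exp_mulVec A (1 : Matrix (Fin n) (Fin n) ℂ) x 0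
  rw [hasDerivAt_iff_tendsto_slope] at hd
  have hd' := hd.mono_left (nhdsWithin_mono (0 : ℝ) (s := Set.Ioi 0) fun y hy => ne_of_gt hy)
  simp only [Complex.ofReal_zero, zero_smul, NormedSpace.exp_zero, Matrix.one_mul,
    one_mulVec] at hd'
  refine (Submodule.closed_of_finiteDimensional (convolvable A C)).mem_of_tendsto hd' ?_
  filter_upwards [self_mem_nhdsWithin] with h hh
  rw [slope_def_module]
  have h1 := hexp h (le_of_lt hh)
  have h2 := hexp 0 le_rfl
  simp only [Matrix.one_mul] at h1 h2
  rw [← Complex.coe_smul]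
  exact Submodule.smul_mem _ _ (Submodule.sub_mem _ h1 h2)

/-- The impulse response `e^{μr} C x` does not decay, so its convolution with the square-integrable
input `1 / (1 + |σ|)` would diverge logarithmically unless `C x = 0`. -/
theorem mulVec_eq_zero_of_mem_convolvable {x : Fin n → ℂ} (hx : x ∈ convolvable A C) {μ : ℂ}
    (hμ : 0 ≤ μ.re) (hAx : A *ᵥ x = μ • x) : C *ᵥ x = 0 := by
  by_contra hC
  have hfm : MemLp (fun σ : ℝ => (((1 + ‖σ‖) ^ (-1 : ℝ) : ℝ) : ℂ)) 2 volume := by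
    have hc : Continuous fun σ : ℝ => (((1 + ‖σ‖) ^ (-1 : ℝ) : ℝ) : ℂ) := by
      refine Complex.continuous_ofReal.comp (Continuous.rpow_const (by fun_prop) fun σ => Or.inl ?_)
      positivity
    refine (memLp_two_iff_integrable_sq_norm hc.aestronglyMeasurable).2 ?_
    have h1 := integrable_one_add_norm (E := ℝ) (μ := volume) (r := 2) (by simp)
    refine h1.congr (Filter.Eventually.of_forall fun σ => ?_)
    simp only
    have h0 : (0 : ℝ) < 1 + ‖σ‖ := by positivity
    rw [Complex.norm_real, Real.norm_of_nonneg (Real.rpow_nonneg h0.le _), ← Real.rpow_natCast,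
      ← Real.rpow_mul h0.le]
    norm_num
  have hi := ((hx _ hfm 0).mono_set (Set.Iic_subset_Iic.2 (by norm_num : (-1 : ℝ) ≤ 0))).norm
  have h2 : IntegrableOn (fun σ : ℝ => σ⁻¹) (Set.Iic (-1)) volume := by
    refine Integrable.mono' (hi.const_mul (2 * ‖C *ᵥ x‖⁻¹))
      (measurable_inv.aestronglyMeasurable) ?_
    filter_upwards [ae_restrict_mem measurableSet_Iic] with σ hσ
    have hσ' : σ ≤ -1 := hσ
    rw [Matrix.exp_mulVec_eigenvector A C hAx, norm_smul, norm_smul, Complex.norm_exp,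
      Complex.norm_real, Real.norm_of_nonneg (Real.rpow_nonneg (by positivity) _), norm_inv,
      Real.norm_of_nonpos (by linarith : σ ≤ 0), Real.rpow_neg_one]
    have h3 : 1 ≤ Real.exp ((((0 - σ : ℝ) : ℂ) * μ).re) := by
      rw [Complex.re_ofReal_mul]
      exact Real.one_le_exp (mul_nonneg (by linarith) hμ)
    have hC' : 0 < ‖C *ᵥ x‖ := norm_pos_iff.2 hC
    -- The factor `2` is enough because `σ ≤ -1`.
    have h4 : (-σ)⁻¹ ≤ 2 * (1 + -σ)⁻¹ := by
      rw [← div_eq_mul_inv, inv_eq_one_div, div_le_div_iff₀ (by linarith) (by linarith)]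
      linarith
    calc (-σ)⁻¹ ≤ 2 * (1 + -σ)⁻¹ * 1 := by rw [mul_one]; exact h4
      _ ≤ 2 * (1 + -σ)⁻¹ * Real.exp ((((0 - σ : ℝ) : ℂ) * μ).re) := by
          refine mul_le_mul_of_nonneg_left h3 (mul_nonneg zero_le_two (inv_nonneg.2 ?_))
          linarith
      _ = _ := by field_simp
  have h5 := h2.mono_set Set.Iio_subset_Iic_self
  have h6 : IntegrableOn (fun σ : ℝ => (-σ)⁻¹) (Set.Ioi 1) volume := by
    have := IntegrableOn.comp_neg_Ioi (c := 1) (f := fun σ : ℝ => σ⁻¹) h5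
    simpa using this
  refine not_integrableOn_Ioi_inv (a := 1) ?_
  simpa [inv_neg] using h6.neg

theorem integral_exp_smul_impulse (hC : convolvable A C = ⊤) {s : ℂ} (hs : 0 < s.re)
    (hsA : IsUnit (s • (1 : Matrix (Fin n) (Fin n) ℂ) - A)) (b : Fin n → ℂ) {t : ℝ} (ht : t ≤ 0) :
    IntegrableOn (fun σ : ℝ => Complex.exp (s * σ) •
      ((C * NormedSpace.exp (((t - σ : ℝ) : ℂ) • A)) *ᵥ b)) (Set.Iic t) volume ∧
    ∫ σ in Set.Iic t, Complex.exp (s * σ) •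
      ((C * NormedSpace.exp (((t - σ : ℝ) : ℂ) • A)) *ᵥ b) =
      Complex.exp (s * t) • ((C * (s • (1 : Matrix (Fin n) (Fin n) ℂ) - A)⁻¹) *ᵥ b) := by
  have hf := memLp_indicator_exp hs
  have hint : ∀ y : Fin n → ℂ, IntegrableOn (fun σ : ℝ => Complex.exp (s * σ) •
      ((C * NormedSpace.exp (((t - σ : ℝ) : ℂ) • A)) *ᵥ y)) (Set.Iic t) volume := fun y => by
    have hy : y ∈ convolvable A C := hC ▸ Submodule.mem_top
    refine (hy _ hf t).congr_fun (fun σ hσ => ?_) measurableSet_Iic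
    simp only
    rw [Set.indicator_of_mem (show σ ∈ Set.Iic (0 : ℝ) from le_trans hσ ht)]
  refine ⟨hint b, ?_⟩
  -- With `b = (s - A) y`, the integrand is the derivative of the same expression with `y` in place
  -- of `b`.
  obtain ⟨y, hy⟩ : ∃ y, y = (s • (1 : Matrix (Fin n) (Fin n) ℂ) - A)⁻¹ *ᵥ b := ⟨_, rfl⟩
  have hyb : s • y - A *ᵥ y = b := by
    have : (s • (1 : Matrix (Fin n) (Fin n) ℂ) - A) *ᵥ y = b := by
      rw [hy, mulVec_mulVec, mul_nonsing_inv _ ((isUnit_iff_isUnit_det _).1 hsA), one_mulVec]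
    rw [← this, sub_mulVec, smul_mulVec, one_mulVec]
  have hderiv : ∀ σ : ℝ, HasDerivAt (fun σ : ℝ => Complex.exp (s * σ) •
      ((C * NormedSpace.exp (((t - σ : ℝ) : ℂ) • A)) *ᵥ y))
      (Complex.exp (s * σ) • ((C * NormedSpace.exp (((t - σ : ℝ) : ℂ) • A)) *ᵥ b)) σ := fun σ => by
    have h1 : HasDerivAt (fun σ : ℝ => Complex.exp (s * σ)) (Complex.exp (s * σ) * (s * 1)) σ :=
      ((hasDerivAt_id σ).ofReal_comp.const_mul s).cexp
    have h2 := (hasDerivAt_exp_mulVec A C y (t - σ)).scomp σ ((hasDerivAt_id σ).const_sub t)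
    refine (h1.smul h2).congr_deriv ?_
    simp only [Function.comp_apply, ← hyb, mulVec_sub, mulVec_smul, neg_smul, one_smul,
      smul_sub, smul_smul, mul_one, smul_neg]
    abel
  -- The primitive vanishes at `-∞` because it and its derivative are both integrable; no decay
  -- estimate for the matrix exponential is used.
  have hlim := tendsto_zero_of_hasDerivAt_of_integrableOn_Iic (a := t) (fun σ _ => hderiv σ)
    (hint b) (hint y)
  rw [integral_Iic_of_hasDerivAt_of_tendsto' (fun σ _ => hderiv σ) (hint b) hlim]
  simp [hy, mulVec_mulVec]

end ImpulseResponse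

theorem Matrix.isUnit_of_forall_mulVec {n : ℕ} {M : Matrix (Fin n) (Fin n) ℂ}
    (h : ∀ x, M *ᵥ x = 0 → x = 0) : IsUnit M := by
  rw [isUnit_iff_isUnit_det, isUnit_iff_ne_zero]
  intro h0
  obtain ⟨v, hv, hv0⟩ := exists_mulVec_eq_zero_iff.2 h0
  exact hv (h v hv0)

theorem MeasureTheory.MemLp.smul_vec {m : ℕ} {f : ℝ → ℂ} (hf : MemLp f 2 volume) (v : Fin m → ℂ) :
    MemLp (fun σ => f σ • v) 2 volume :=
  (ContinuousLinearMap.toSpanSingleton ℂ v).comp_memLp' hf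

/-! ### Stability of the plant and positivity of its continuous-time Pick form. -/

namespace Plant

variable {nP nw nu nz : ℕ} {P : Plant nP nw nu nz}

/-- Bounded gain makes the columns of `B_w` and `B_u` convolvable. The convolvable directions form
an `A`-invariant subspace, so controllability yields all of them. -/
theorem convolvable_eq_top (hmin : P.toRealization.IsMinimal) (hgain : P.HasBoundedGain) :
    convolvable P.A P.Cz = ⊤ ∧ convolvable P.A P.Cy = ⊤ := by
  obtain ⟨γ, -, hγ⟩ := hgain
  have hV : convolvable P.A P.Cz ⊓ convolvable P.A P.Cy = ⊤ := by
    refine hmin.eq_top _ (fun v hv => ⟨mulVec_mem_convolvable _ _ hv.1,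
      mulVec_mem_convolvable _ _ hv.2⟩) fun j => ?_
    -- The unit vector indexed by `j` is sent to the channel it belongs to; the other input is zero.
    have hker : ∀ {p : ℕ} (C : Matrix (Fin p) (Fin nP) ℂ) (f : ℝ → ℂ) (t : ℝ),
        (fun σ : ℝ => f σ • ((C * NormedSpace.exp (((t - σ : ℝ) : ℂ) • P.A)) *ᵥ
          fun i => P.toRealization.B i j)) =
        P.kernel C (fun σ => f σ • fun k => if Sum.inl k = j then 1 else 0)
          (fun σ => f σ • fun k => if Sum.inr k = j then 1 else 0) t := by
      intro p C f t
      funext σ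
      rw [kernel, ← mulVec_smul]
      congr 1
      rw [mulVec_smul, mulVec_smul, ← smul_add]
      congr 1
      ext i
      rcases j with j | j <;> simp [toRealization, mulVec, dotProduct]
    refine ⟨fun f hf t => ?_, fun f hf t => ?_⟩
    · rw [hker]
      exact (hγ _ _ (hf.smul_vec _) (hf.smul_vec _)).1 t
    · rw [hker]
      exact (hγ _ _ (hf.smul_vec _) (hf.smul_vec _)).2.1 t
  exact ⟨eq_top_iff.2 (hV ▸ inf_le_left), eq_top_iff.2 (hV ▸ inf_le_right)⟩

/-- A minimal plant of bounded gain is stable. -/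
theorem isUnit_smul_one_sub_A (hmin : P.toRealization.IsMinimal) (hgain : P.HasBoundedGain) {s : ℂ}
    (hs : 0 ≤ s.re) : IsUnit (s • (1 : Matrix (Fin nP) (Fin nP) ℂ) - P.A) := by
  obtain ⟨hz, hy⟩ := convolvable_eq_top hmin hgain
  refine isUnit_of_forall_mulVec fun x hx => ?_
  have hAx : P.A *ᵥ x = s • x := by
    rw [sub_mulVec, smul_mulVec, one_mulVec] at hx
    exact (sub_eq_zero.1 hx).symm
  refine hmin.eq_zero_of_mulVec_eq_zero hAx ?_
  have h1 := mulVec_eq_zero_of_mem_convolvable P.A P.Cz (hz ▸ Submodule.mem_top) hs hAx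
  have h2 := mulVec_eq_zero_of_mem_convolvable P.A P.Cy (hy ▸ Submodule.mem_top) hs hAx
  ext i
  rcases i with i | i
  · simpa [toRealization, mulVec, dotProduct] using congrFun h1 i
  · simpa [toRealization, mulVec, dotProduct] using congrFun h2 i

/-- Inputs that are sums of exponentials up to time zero turn passivity into positivity of the
continuous-time Pick form. -/
theorem pick_nonneg (hmin : P.toRealization.IsMinimal) (hgain : P.HasBoundedGain)
    (hpass : P.IsPassive) {ι : Type} (F : Finset ι) (s : ι → ℂ) (hs : ∀ i, 0 < (s i).re)
    (u : ι → Fin nu → ℂ) :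
    0 ≤ (∑ i ∈ F, ∑ j ∈ F, (star (u i) ⬝ᵥ (P.hatPuy (s j) *ᵥ u j)) /
      ((starRingEnd ℂ) (s i) + s j)).re := by
  obtain ⟨-, hy⟩ := convolvable_eq_top hmin hgain
  obtain ⟨β, hβ, hpass⟩ := hpass
  have key : ∀ u : ι → Fin nu → ℂ, -β 0 ≤
      2 * (∑ i ∈ F, ∑ j ∈ F, (star (u i) ⬝ᵥ (P.hatPuy (s j) *ᵥ u j)) /
        ((starRingEnd ℂ) (s i) + s j)).re := by
    intro u
    let f : ι → ℝ → ℂ := fun i => Set.indicator (Set.Iic 0) fun σ : ℝ => Complex.exp (s i * σ)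
    let U : ℝ → Fin nu → ℂ := fun t => ∑ i ∈ F, f i t • u i
    have hf : ∀ i (t : ℝ), t ≤ 0 → f i t = Complex.exp (s i * t) := fun i t ht =>
      Set.indicator_of_mem (show t ∈ Set.Iic (0 : ℝ) from ht) _
    have hU : MemLp U 2 volume := memLp_finsetSum F fun i _ =>
      (memLp_indicator_exp (hs i)).smul_vec (u i)
    have hU0 : ∀ t, 0 < t → U t = 0 := fun t ht => Finset.sum_eq_zero fun i _ => by
      rw [show f i t = 0 from Set.indicator_of_notMem (by simpa using ht) _, zero_smul]
    have hUt : ∀ t, t ≤ 0 → U t = ∑ i ∈ F, Complex.exp (s i * t) • u i := fun t ht =>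
      Finset.sum_congr rfl fun i _ => by rw [hf i t ht]
    have hY : ∀ t, t ≤ 0 → P.outY 0 U t =
        ∑ i ∈ F, Complex.exp (s i * t) • (P.hatPuy (s i) *ᵥ u i) := by
      intro t ht
      have hker : ∀ σ ∈ Set.Iic t, P.kernel P.Cy 0 U t σ = ∑ i ∈ F, Complex.exp (s i * σ) •
          ((P.Cy * NormedSpace.exp (((t - σ : ℝ) : ℂ) • P.A)) *ᵥ (P.Bu *ᵥ u i)) := fun σ hσ => by
        rw [kernel, hUt σ (le_trans hσ ht), Pi.zero_apply, mulVec_zero, zero_add, mulVec_sum,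
          mulVec_sum]
        simp only [mulVec_smul]
      have hi := fun i => integral_exp_smul_impulse P.A P.Cy hy (hs i)
        (isUnit_smul_one_sub_A hmin hgain (hs i).le) (P.Bu *ᵥ u i) ht
      rw [outY, setIntegral_congr_fun measurableSet_Iic hker,
        integral_finsetSum _ fun i _ => (hi i).1, hUt t ht, mulVec_sum, ← Finset.sum_add_distrib]
      refine Finset.sum_congr rfl fun i _ => ?_
      rw [(hi i).2, mulVec_smul, ← smul_add, hatPuy, Realization.transfer, add_mulVec, mulVec_mulVec]
    refine (hpass 0 U (MemLp.zero') hU).trans_eq ?_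
    have hpos : ∀ i j, 0 < ((starRingEnd ℂ) (s i) + s j).re := fun i j => by
      simpa using add_pos (hs i) (hs j)
    have hint : ∀ t : ℝ, t ∈ Set.Iic (0 : ℝ) →
        (star (U t) ⬝ᵥ P.outY 0 U t + star (P.outY 0 U t) ⬝ᵥ U t).re =
        (∑ i ∈ F, ∑ j ∈ F, Complex.exp (((starRingEnd ℂ) (s i) + s j) * t) *
          (2 * (star (u i) ⬝ᵥ (P.hatPuy (s j) *ᵥ u j)))).re := by
      intro t ht
      have h1 : star (P.outY 0 U t) ⬝ᵥ U t = (starRingEnd ℂ) (star (U t) ⬝ᵥ P.outY 0 U t) := by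
        rw [starRingEnd_apply, ← star_dotProduct_star, star_star, dotProduct_comm]
      rw [Complex.add_re, h1, Complex.conj_re, ← two_mul, hY t ht, hUt t ht, star_sum,
        sum_dotProduct, ← Complex.re_ofReal_mul, Finset.mul_sum]
      congr 1
      refine Finset.sum_congr rfl fun i _ => ?_
      rw [dotProduct_sum, Finset.mul_sum]
      refine Finset.sum_congr rfl fun j _ => ?_
      rw [star_smul, smul_dotProduct, dotProduct_smul, smul_eq_mul, smul_eq_mul, add_mul,
        Complex.exp_add, Complex.star_def, ← Complex.exp_conj, map_mul, Complex.conj_ofReal]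
      push_cast
      ring
    have hterm : ∀ i j, IntegrableOn (fun t : ℝ =>
        Complex.exp (((starRingEnd ℂ) (s i) + s j) * t) *
          (2 * (star (u i) ⬝ᵥ (P.hatPuy (s j) *ᵥ u j)))) (Set.Iic 0) volume := fun i j =>
      (integrableOn_exp_mul_complex_Iic (hpos i j) 0).mul_const _
    -- The output persists after time zero, but the input is zero there, so only the past enters the
    -- supplied energy.
    rw [← setIntegral_eq_integral_of_forall_compl_eq_zero (s := Set.Iic (0 : ℝ)) fun t ht => by
      rw [hU0 t (by simpa using ht)]; simp]
    rw [setIntegral_congr_fun measurableSet_Iic hint]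
    have hre := integral_re (𝕜 := ℂ) (integrable_finsetSum F fun i _ =>
      integrable_finsetSum F fun j _ => hterm i j)
    simp only [RCLike.re_to_complex] at hre
    refine hre.trans ?_
    rw [integral_finsetSum _ fun i _ => integrable_finsetSum F fun j _ => hterm i j,
      ← Complex.re_ofReal_mul, Finset.mul_sum]
    congr 1
    refine Finset.sum_congr rfl fun i _ => ?_
    rw [integral_finsetSum _ fun j _ => hterm i j, Finset.mul_sum]
    refine Finset.sum_congr rfl fun j _ => ?_
    rw [integral_mul_const, integral_exp_mul_complex_Iic (hpos i j)]
    push_cast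
    simp
    ring
  -- The Pick form is quadratic in `u` while `β 0` is fixed: scaling `u` by a large factor turns the
  -- lower bound `-β 0` into nonnegativity.
  by_contra! hneg
  obtain ⟨c, hc⟩ := exists_nat_gt (β 0 / (-(∑ i ∈ F, ∑ j ∈ F,
    (star (u i) ⬝ᵥ (P.hatPuy (s j) *ᵥ u j)) / ((starRingEnd ℂ) (s i) + s j)).re))
  rw [div_lt_iff₀ (by linarith)] at hc
  have h1 := key fun i => (((c : ℝ) + 1 : ℝ) : ℂ) • u i
  have h2 : (∑ i ∈ F, ∑ j ∈ F, (star ((((c : ℝ) + 1 : ℝ) : ℂ) • u i) ⬝ᵥ (P.hatPuy (s j) *ᵥ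
      ((((c : ℝ) + 1 : ℝ) : ℂ) • u j))) / ((starRingEnd ℂ) (s i) + s j)) =
      (((((c : ℝ) + 1) ^ 2 : ℝ)) : ℂ) * ∑ i ∈ F, ∑ j ∈ F,
        (star (u i) ⬝ᵥ (P.hatPuy (s j) *ᵥ u j)) / ((starRingEnd ℂ) (s i) + s j) := by
    rw [Finset.mul_sum]
    refine Finset.sum_congr rfl fun i _ => ?_
    rw [Finset.mul_sum]
    refine Finset.sum_congr rfl fun j _ => ?_
    rw [star_smul, smul_dotProduct, mulVec_smul, dotProduct_smul, smul_eq_mul, smul_eq_mul,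
      Complex.star_def, Complex.conj_ofReal]
    push_cast
    ring
  rw [h2, Complex.re_ofReal_mul] at h1
  have h3 := hβ 0
  have hc0 : (0 : ℝ) ≤ c := Nat.cast_nonneg c
  nlinarith

end Plant

/-! ### Stable matrices, `H∞` transfer functions and their inverses. -/

/-- All eigenvalues lie in the open unit disc. -/
def Matrix.IsSchur {n : ℕ} (A : Matrix (Fin n) (Fin n) ℂ) : Prop :=
  ∀ q : ℂ, 1 ≤ ‖q‖ → IsUnit (q • (1 : Matrix (Fin n) (Fin n) ℂ) - A)

/-- The spectral radius is below one, so Gelfand's formula eventually bounds `‖a ^ k‖` by a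
geometric sequence. The zero ring, which arises from a zero-dimensional state space, is treated
apart. -/
theorem summable_norm_pow_of_isUnit {R : Type*} [NormedRing R] [NormedAlgebra ℂ R]
    [CompleteSpace R] {a : R} (h : ∀ q : ℂ, 1 ≤ ‖q‖ → IsUnit (q • (1 : R) - a)) :
    Summable fun k : ℕ => ‖a ^ k‖ := by
  rcases subsingleton_or_nontrivial R with hR | hR
  · simp only [Subsingleton.elim _ (0 : R), norm_zero]
    exact summable_zero
  have h1 : spectralRadius ℂ a < (1 : NNReal) := by
    refine spectrum.spectralRadius_lt_of_forall_lt a fun z hz => ?_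
    by_contra hlt
    refine hz ?_
    rw [spectrum.mem_resolventSet_iff, Algebra.algebraMap_eq_smul_one]
    exact h z (NNReal.coe_le_coe.2 (not_lt.1 hlt))
  obtain ⟨r, hr1, hr2⟩ := ENNReal.lt_iff_exists_nnreal_btwn.1 h1
  have h2 := (spectrum.pow_nnnorm_pow_one_div_tendsto_nhds_spectralRadius a).eventually
    (gt_mem_nhds hr1)
  have hr : (r : ℝ) < 1 := by exact_mod_cast hr2
  refine Summable.of_norm_bounded_eventually_nat (summable_geometric_of_lt_one r.2 hr) ?_
  filter_upwards [h2, Filter.eventually_gt_atTop 0] with k hk hk0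
  have hk' : (0 : ℝ) < 1 / k := by positivity
  have h3 : (‖a ^ k‖₊ : ENNReal) < (r : ENNReal) ^ k := by
    have h4 := ENNReal.rpow_lt_rpow hk (show (0 : ℝ) < k by positivity)
    rwa [← ENNReal.rpow_mul, one_div_mul_cancel (by positivity), ENNReal.rpow_one,
      ENNReal.rpow_natCast] at h4
  rw [norm_norm]
  exact_mod_cast h3.le

section MatrixNorm

attribute [local instance] Matrix.linftyOpNormedRing Matrix.linftyOpNormedAlgebra
  Matrix.linftyOpNormedAddCommGroup Matrix.linftyOpNormedSpace

variable {n m p : ℕ}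

theorem Matrix.IsSchur.tendsto_pow {A : Matrix (Fin n) (Fin n) ℂ} (hA : A.IsSchur) :
    Filter.Tendsto (fun k : ℕ => A ^ k) Filter.atTop (nhds 0) :=
  tendsto_zero_iff_norm_tendsto_zero.2 (summable_norm_pow_of_isUnit hA).tendsto_atTop_zero

theorem Matrix.resolvent_eq (A : Matrix (Fin n) (Fin n) ℂ) :
    resolvent A = fun q : ℂ => (q • (1 : Matrix (Fin n) (Fin n) ℂ) - A)⁻¹ := by
  funext q
  rw [resolvent, Algebra.algebraMap_eq_smul_one, nonsing_inv_eq_ringInverse]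

theorem Matrix.differentiableAt_resolvent {A : Matrix (Fin n) (Fin n) ℂ} {q : ℂ}
    (hq : IsUnit (q • (1 : Matrix (Fin n) (Fin n) ℂ) - A)) :
    DifferentiableAt ℂ (fun q : ℂ => (q • (1 : Matrix (Fin n) (Fin n) ℂ) - A)⁻¹) q := by
  rw [← resolvent_eq]
  refine (spectrum.hasDerivAt_resolvent_const_left ?_).differentiableAt
  rwa [spectrum.mem_resolventSet_iff, Algebra.algebraMap_eq_smul_one]

theorem Realization.exists_transfer_apply_eq (G : Realization (Fin n) (Fin m) (Fin p)) (i : Fin p)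
    (j : Fin m) : ∃ ℓ : Matrix (Fin n) (Fin n) ℂ →L[ℂ] ℂ, ∀ q, G.transfer q i j =
      ℓ (q • (1 : Matrix (Fin n) (Fin n) ℂ) - G.A)⁻¹ + G.D i j := by
  let ℓ : Matrix (Fin n) (Fin n) ℂ →ₗ[ℂ] ℂ :=
    { toFun := fun M => (G.C * M * G.B) i j
      map_add' := fun M N => by rw [Matrix.mul_add, Matrix.add_mul]; rfl
      map_smul' := fun c M => by rw [Matrix.mul_smul, Matrix.smul_mul]; rfl }
  exact ⟨LinearMap.toContinuousLinearMap ℓ, fun q => rfl⟩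

theorem Realization.differentiableAt_transfer_apply (G : Realization (Fin n) (Fin m) (Fin p))
    {q : ℂ} (hq : IsUnit (q • (1 : Matrix (Fin n) (Fin n) ℂ) - G.A)) (i : Fin p) (j : Fin m) :
    DifferentiableAt ℂ (fun q => G.transfer q i j) q := by
  obtain ⟨ℓ, hℓ⟩ := G.exists_transfer_apply_eq i j
  simp only [hℓ]
  exact (ℓ.differentiableAt.comp q (differentiableAt_resolvent hq)).add_const _

theorem Realization.tendsto_transfer (G : Realization (Fin n) (Fin m) (Fin p)) (i : Fin p)
    (j : Fin m) :
    Filter.Tendsto (fun q => G.transfer q i j) (Bornology.cobounded ℂ) (nhds (G.D i j)) := by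
  obtain ⟨ℓ, hℓ⟩ := G.exists_transfer_apply_eq i j
  simp only [hℓ]
  have h1 := spectrum.resolvent_tendsto_cobounded G.A (𝕜 := ℂ)
  rw [resolvent_eq] at h1
  simpa using ((ℓ.continuous.tendsto 0).comp h1).add_const (G.D i j)

theorem Realization.exists_transfer_apply_bound {G : Realization (Fin n) (Fin m) (Fin p)}
    (hA : G.A.IsSchur) (i : Fin p) (j : Fin m) :
    ∃ M : ℝ, ∀ q : ℂ, 1 < ‖q‖ → ‖G.transfer q i j‖ ≤ M := by
  have h1 := (G.tendsto_transfer i j).norm.eventually (gt_mem_nhds (lt_add_one ‖G.D i j‖))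
  rw [← comap_norm_atTop, Filter.eventually_comap, Filter.eventually_atTop] at h1
  obtain ⟨r, hr⟩ := h1
  -- Beyond radius `r` the limit `D` at infinity bounds the entry. The remaining closed annulus
  -- includes the unit circle, where stability still gives continuity.
  have hK : IsCompact (Metric.closedBall (0 : ℂ) r \ Metric.ball 0 1) :=
    (isCompact_closedBall 0 r).diff Metric.isOpen_ball
  obtain ⟨M, hM⟩ := hK.exists_bound_of_continuousOn (f := fun q => G.transfer q i j) fun q hq =>
    (G.differentiableAt_transfer_apply
      (hA q (by simpa using hq.2)) i j).continuousAt.continuousWithinAt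
  refine ⟨max M (‖G.D i j‖ + 1), fun q hq => ?_⟩
  rcases le_total ‖q‖ r with h | h
  · exact (hM q ⟨by simpa using h, by simpa using hq.le⟩).trans (le_max_left _ _)
  · exact (hr ‖q‖ h q rfl).le.trans (le_max_right _ _)

/-- A stable realization has its transfer function in `H∞`. -/
theorem Realization.isHInfty_transfer {G : Realization (Fin n) (Fin m) (Fin p)}
    (hA : G.A.IsSchur) : IsHInfty G.transfer := by
  have hopen : IsOpen {q : ℂ | 1 < ‖q‖} := isOpen_lt continuous_const continuous_norm
  refine ⟨fun i j => DifferentiableOn.analyticOnNhd (fun q hq =>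
    (G.differentiableAt_transfer_apply (hA q (le_of_lt hq)) i j).differentiableWithinAt) hopen, ?_⟩
  choose M hM using exists_transfer_apply_bound hA
  refine ⟨∑ i, ∑ j, |M i j|, fun q hq i j => (hM i j q hq).trans ((le_abs_self _).trans ?_)⟩
  refine (Finset.single_le_sum (f := fun j => |M i j|) (fun j _ => abs_nonneg _)
    (Finset.mem_univ j)).trans ?_
  exact Finset.single_le_sum (f := fun i => ∑ j, |M i j|)
    (fun i _ => Finset.sum_nonneg fun j _ => abs_nonneg _) (Finset.mem_univ i)

theorem Realization.differentiableAt_transfer_inv_apply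
    (G : Realization (Fin n) (Fin m) (Fin m)) {q : ℂ}
    (hq : IsUnit (q • (1 : Matrix (Fin n) (Fin n) ℂ) - G.A)) (hG : IsUnit (G.transfer q))
    (i j : Fin m) : DifferentiableAt ℂ (fun q => (G.transfer q)⁻¹ i j) q := by
  let ℓ : Matrix (Fin n) (Fin n) ℂ →ₗ[ℂ] Matrix (Fin m) (Fin m) ℂ :=
    { toFun := fun M => G.C * M * G.B
      map_add' := fun M N => by rw [Matrix.mul_add, Matrix.add_mul]
      map_smul' := fun c M => by rw [Matrix.mul_smul, Matrix.smul_mul]; rfl }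
  let e : Matrix (Fin m) (Fin m) ℂ →ₗ[ℂ] ℂ :=
    { toFun := fun M => M i j
      map_add' := fun M N => rfl
      map_smul' := fun c M => rfl }
  have h1 : DifferentiableAt ℂ G.transfer q :=
    ((LinearMap.toContinuousLinearMap ℓ).differentiableAt.comp q
      (differentiableAt_resolvent hq)).add_const G.D
  have h2 : DifferentiableAt ℂ (fun q => Ring.inverse (G.transfer q)) q :=
    (differentiableAt_inverse (𝕜 := ℂ) hG).comp q h1
  simp only [nonsing_inv_eq_ringInverse]
  exact (LinearMap.toContinuousLinearMap e).differentiableAt.comp q h2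

end MatrixNorm

namespace Realization

variable {n m : ℕ}

/-- The realization of the inverse of an invertible transfer function. -/
noncomputable def inverse (S : Realization (Fin n) (Fin m) (Fin m)) :
    Realization (Fin n) (Fin m) (Fin m) :=
  ⟨S.PhiF, S.B * S.D⁻¹, -(S.D⁻¹ * S.C), S.D⁻¹⟩

theorem transfer_mul_transfer_inverse {S : Realization (Fin n) (Fin m) (Fin m)} (hD : IsUnit S.D)
    {q : ℂ} (hA : IsUnit (q • (1 : Matrix (Fin n) (Fin n) ℂ) - S.A))
    (hF : IsUnit (q • (1 : Matrix (Fin n) (Fin n) ℂ) - S.PhiF)) :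
    S.transfer q * S.inverse.transfer q = 1 := by
  rw [isUnit_iff_isUnit_det] at hD hA hF
  -- The second resolvent identity for `A` and `Φ_F`, which differ by `B D⁻¹ C`.
  have hXY : (q • (1 : Matrix (Fin n) (Fin n) ℂ) - S.A)⁻¹ -
      (q • (1 : Matrix (Fin n) (Fin n) ℂ) - S.PhiF)⁻¹ =
      (q • (1 : Matrix (Fin n) (Fin n) ℂ) - S.A)⁻¹ * (S.B * S.D⁻¹ * S.C) *
        (q • (1 : Matrix (Fin n) (Fin n) ℂ) - S.PhiF)⁻¹ := by
    have h1 : S.B * S.D⁻¹ * S.C = (q • (1 : Matrix (Fin n) (Fin n) ℂ) - S.PhiF) -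
        (q • (1 : Matrix (Fin n) (Fin n) ℂ) - S.A) := by
      rw [PhiF]; abel
    rw [h1, Matrix.mul_sub, nonsing_inv_mul _ hA, Matrix.sub_mul, Matrix.one_mul, Matrix.mul_assoc,
      mul_nonsing_inv _ hF, Matrix.mul_one]
  rw [transfer, transfer, inverse]
  generalize (q • (1 : Matrix (Fin n) (Fin n) ℂ) - S.A)⁻¹ = X at *
  generalize (q • (1 : Matrix (Fin n) (Fin n) ℂ) - S.PhiF)⁻¹ = Y at *
  have h2 : S.D * S.D⁻¹ = 1 := mul_nonsing_inv _ hD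
  have h3 : (S.C * X * S.B + S.D) * (-(S.D⁻¹ * S.C) * Y * (S.B * S.D⁻¹) + S.D⁻¹) =
      S.C * (X - Y - X * (S.B * S.D⁻¹ * S.C) * Y) * (S.B * S.D⁻¹) + S.D * S.D⁻¹ +
      (1 - S.D * S.D⁻¹) * (S.C * Y * S.B * S.D⁻¹) := by
    simp only [Matrix.add_mul, Matrix.mul_add, Matrix.sub_mul, Matrix.mul_sub, Matrix.neg_mul,
      Matrix.mul_neg, Matrix.mul_assoc, Matrix.one_mul]
    abel
  rw [h3, h2, hXY, sub_self, sub_self]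
  simp

theorem isHInftyUnit_transfer {S : Realization (Fin n) (Fin m) (Fin m)} (hD : IsUnit S.D)
    (hA : S.A.IsSchur) (hF : S.PhiF.IsSchur) : IsHInftyUnit S.transfer := by
  have h1 : ∀ q : ℂ, 1 < ‖q‖ → S.transfer q * S.inverse.transfer q = 1 := fun q hq =>
    transfer_mul_transfer_inverse hD (hA q hq.le) (hF q hq.le)
  obtain ⟨h2, M, hM⟩ := isHInfty_transfer (G := S.inverse) hF
  have h3 : ∀ q : ℂ, 1 < ‖q‖ → (S.transfer q)⁻¹ = S.inverse.transfer q := fun q hq =>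
    inv_eq_right_inv (h1 q hq)
  refine ⟨isHInfty_transfer hA, fun q hq => IsUnit.of_mul_eq_one _ (h1 q hq), fun i j => ?_, M,
    fun q hq i j => (congrArg norm (congrFun₂ (h3 q hq) i j)).trans_le (hM q hq i j)⟩
  have hopen : IsOpen {q : ℂ | 1 < ‖q‖} := isOpen_lt continuous_const continuous_norm
  exact (h2 i j).congr hopen fun q hq => (congrFun₂ (h3 q hq) i j).symm

end Realization

/-! ### The bilinear transformation. -/

namespace Plant

variable {nP nw nu nz : ℕ} {P : Plant nP nw nu nz}

/-- The discrete-time realization of the channel `u ↦ y`. -/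
noncomputable def tildeRealization (P : Plant nP nw nu nz) (τ : ℝ) :
    Realization (Fin nP) (Fin nu) (Fin nu) :=
  ⟨P.Phi τ, P.GammaU τ, P.PiY τ, P.DeltaUY τ⟩

variable {τ : ℝ}

theorem smul_one_sub_Phi (hτ : 0 < τ)
    (hN : IsUnit (1 - (2 * (τ : ℂ)) • P.A)) {q : ℂ} (hq : q ≠ -1) :
    q • (1 : Matrix (Fin nP) (Fin nP) ℂ) - P.Phi τ = (2 * (τ : ℂ) * (q + 1)) •
      (((1 / (2 * (τ : ℂ)) * ((q - 1) / (q + 1))) • (1 : Matrix (Fin nP) (Fin nP) ℂ) - P.A) *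
        (1 - (2 * (τ : ℂ)) • P.A)⁻¹) := by
  have hτ' : (τ : ℂ) ≠ 0 := by exact_mod_cast hτ.ne'
  have hq' : q + 1 ≠ 0 := fun h => hq (eq_neg_of_add_eq_zero_left h)
  have h1 : (1 - (2 * (τ : ℂ)) • P.A) * (1 - (2 * (τ : ℂ)) • P.A)⁻¹ = 1 :=
    mul_nonsing_inv _ ((isUnit_iff_isUnit_det _).1 hN)
  have h2 : (2 * (τ : ℂ) * (q + 1)) •
      ((1 / (2 * (τ : ℂ)) * ((q - 1) / (q + 1))) • (1 : Matrix (Fin nP) (Fin nP) ℂ) - P.A) =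
      q • (1 - (2 * (τ : ℂ)) • P.A) - (1 + (2 * (τ : ℂ)) • P.A) := by
    rw [smul_sub, smul_smul]
    have : 2 * (τ : ℂ) * (q + 1) * (1 / (2 * (τ : ℂ)) * ((q - 1) / (q + 1))) = q - 1 := by
      field_simp
    rw [this]
    module
  rw [← Matrix.smul_mul, h2, Matrix.sub_mul, Matrix.smul_mul, h1, Phi]

theorem tildePuy_eq (hτ : 0 < τ) (hN : IsUnit (1 - (2 * (τ : ℂ)) • P.A)) {q : ℂ} (hq : q ≠ -1)
    (hΦ : IsUnit (q • (1 : Matrix (Fin nP) (Fin nP) ℂ) - P.Phi τ)) :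
    P.tildePuy τ q = (P.tildeRealization τ).transfer q := by
  have hτ' : (τ : ℂ) ≠ 0 := by exact_mod_cast hτ.ne'
  have hq' : q + 1 ≠ 0 := fun h => hq (eq_neg_of_add_eq_zero_left h)
  have h0 := smul_one_sub_Phi hτ hN hq
  rw [tildePuy, hatPuy, Realization.transfer, Realization.transfer, tildeRealization]
  simp only [PiY, GammaU, DeltaUY]
  generalize 1 / (2 * (τ : ℂ)) * ((q - 1) / (q + 1)) = s at *
  have h1 := (isUnit_iff_isUnit_det _).1 hN
  have h2 := (isUnit_iff_isUnit_det _).1 hΦ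
  have h3 : P.Phi τ = (2 : ℂ) • (1 - (2 * (τ : ℂ)) • P.A)⁻¹ - 1 := by
    have : (1 + (2 * (τ : ℂ)) • P.A) = (2 : ℂ) • (1 : Matrix (Fin nP) (Fin nP) ℂ) -
        (1 - (2 * (τ : ℂ)) • P.A) := by module
    rw [Phi, this, Matrix.sub_mul, mul_nonsing_inv _ h1, Matrix.smul_mul, Matrix.one_mul]
  generalize 1 - (2 * (τ : ℂ)) • P.A = N at *
  generalize hQ : q • (1 : Matrix (Fin nP) (Fin nP) ℂ) - P.Phi τ = Q at *
  have h4 : (s • (1 : Matrix (Fin nP) (Fin nP) ℂ) - P.A)⁻¹ =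
      (2 * (τ : ℂ) * (q + 1)) • (N⁻¹ * Q⁻¹) := by
    refine inv_eq_right_inv ?_
    rw [Matrix.mul_smul, ← Matrix.mul_assoc, ← Matrix.smul_mul, ← h0, mul_nonsing_inv _ h2]
  -- This uses `Φ = 2 N⁻¹ - 1`, hence `q + 1 = 2 N⁻¹ + Q`; the summand `1` produces the extra
  -- feedthrough in `Δ_uy`.
  have h5 : (q + 1) • Q⁻¹ = (2 : ℂ) • (Q⁻¹ * N⁻¹) + 1 := by
    have : (q + 1) • (1 : Matrix (Fin nP) (Fin nP) ℂ) = (2 : ℂ) • N⁻¹ + Q := by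
      rw [← hQ, h3]; module
    calc (q + 1) • Q⁻¹ = Q⁻¹ * ((q + 1) • (1 : Matrix (Fin nP) (Fin nP) ℂ)) := by
          rw [Matrix.mul_smul, Matrix.mul_one]
      _ = _ := by rw [this, Matrix.mul_add, Matrix.mul_smul, nonsing_inv_mul _ h2]
  rw [h4, mul_smul, ← Matrix.mul_smul, h5]
  simp only [Matrix.mul_smul, Matrix.smul_mul, Matrix.mul_add, Matrix.add_mul, Matrix.mul_one,
    smul_add, smul_smul, Matrix.mul_assoc]
  module

/-- The real part is `(|q|² - 1) / (2τ |q + 1|²)`. At `q = -1` division by zero gives the value `0`,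
for which the bound still holds. -/
theorem re_bilinear_nonneg (hτ : 0 < τ) {q : ℂ} (hq : 1 ≤ ‖q‖) :
    0 ≤ (1 / (2 * (τ : ℂ)) * ((q - 1) / (q + 1))).re := by
  have h1 : (1 / (2 * (τ : ℂ))) = ((1 / (2 * τ) : ℝ) : ℂ) := by push_cast; rfl
  have h2 : ((q - 1) / (q + 1)).re = (Complex.normSq q - 1) / Complex.normSq (q + 1) := by
    rw [Complex.div_re, ← add_div]
    congr 1
    simp [Complex.normSq_apply]
    ring
  rw [h1, Complex.re_ofReal_mul, h2, Complex.normSq_eq_norm_sq q]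
  have h3 : 0 ≤ ‖q‖ ^ 2 - 1 := by nlinarith
  have := Complex.normSq_nonneg (q + 1)
  positivity

theorem isUnit_one_sub_smul_A (hmin : P.toRealization.IsMinimal) (hgain : P.HasBoundedGain)
    (hτ : 0 < τ) : IsUnit (1 - (2 * (τ : ℂ)) • P.A) := by
  have hτ' : (τ : ℂ) ≠ 0 := by exact_mod_cast hτ.ne'
  have h1 : (1 / (2 * (τ : ℂ))) = ((1 / (2 * τ) : ℝ) : ℂ) := by push_cast; rfl
  have h2 := isUnit_smul_one_sub_A hmin hgain (s := 1 / (2 * (τ : ℂ))) (by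
    rw [h1, Complex.ofReal_re]; positivity)
  have h3 : 1 - (2 * (τ : ℂ)) • P.A = (2 * (τ : ℂ)) •
      ((1 / (2 * (τ : ℂ))) • (1 : Matrix (Fin nP) (Fin nP) ℂ) - P.A) := by
    rw [smul_sub, smul_smul, mul_one_div_cancel (by simpa using hτ'), one_smul]
  rw [h3]
  exact h2.smul (Units.mk0 (2 * (τ : ℂ)) (by simpa using hτ'))

theorem isSchur_Phi (hmin : P.toRealization.IsMinimal) (hgain : P.HasBoundedGain) (hτ : 0 < τ) :
    (P.Phi τ).IsSchur := by
  intro q hq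
  have hτ' : (τ : ℂ) ≠ 0 := by exact_mod_cast hτ.ne'
  have hN := isUnit_one_sub_smul_A hmin hgain hτ
  have h1 := (isUnit_iff_isUnit_det _).1 hN
  have hNi : IsUnit (1 - (2 * (τ : ℂ)) • P.A)⁻¹ := isUnit_nonsing_inv_iff.2 hN
  by_cases hq1 : q = -1
  -- The point `q = -1` corresponds to `s = ∞`, where the factorization through `s - A` degenerates.
  · have h3 : q • (1 : Matrix (Fin nP) (Fin nP) ℂ) - P.Phi τ =
        (-2 : ℂ) • (1 - (2 * (τ : ℂ)) • P.A)⁻¹ := by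
      have : (1 + (2 * (τ : ℂ)) • P.A) = (2 : ℂ) • (1 : Matrix (Fin nP) (Fin nP) ℂ) -
          (1 - (2 * (τ : ℂ)) • P.A) := by module
      rw [Phi, this, Matrix.sub_mul, mul_nonsing_inv _ h1, Matrix.smul_mul, Matrix.one_mul, hq1]
      module
    rw [h3]
    exact hNi.smul (Units.mk0 (-2 : ℂ) (by norm_num))
  · have hq' : q + 1 ≠ 0 := fun h => hq1 (eq_neg_of_add_eq_zero_left h)
    rw [smul_one_sub_Phi hτ hN hq1]
    exact ((isUnit_smul_one_sub_A hmin hgain (re_bilinear_nonneg hτ hq)).mul hNi).smul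
      (Units.mk0 (2 * (τ : ℂ) * (q + 1)) (by simp [hτ', hq']))

end Plant

/-! ### The Riccati equation in matrix form. -/

section Riccati

open scoped InnerProduct InnerProductSpace

variable {n m : ℕ}

/-- The operator between Euclidean spaces given by a matrix. -/
noncomputable def Matrix.euclCLM (M : Matrix (Fin m) (Fin n) ℂ) :
    EuclideanSpace ℂ (Fin n) →L[ℂ] EuclideanSpace ℂ (Fin m) :=
  LinearMap.toContinuousLinearMap (toEuclideanLin M)

theorem Matrix.adjoint_euclCLM (M : Matrix (Fin m) (Fin n) ℂ) :
    ContinuousLinearMap.adjoint M.euclCLM = Mᴴ.euclCLM := by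
  rw [euclCLM, euclCLM, toEuclideanLin_conjTranspose_eq_adjoint,
    LinearMap.adjoint_toContinuousLinearMap]

theorem Matrix.exists_euclCLM_eq (L : EuclideanSpace ℂ (Fin n) →L[ℂ] EuclideanSpace ℂ (Fin m)) :
    ∃ M : Matrix (Fin m) (Fin n) ℂ, M.euclCLM = L := by
  obtain ⟨M, hM⟩ := toEuclideanLin.surjective
    (L : EuclideanSpace ℂ (Fin n) →ₗ[ℂ] EuclideanSpace ℂ (Fin m))
  exact ⟨M, ContinuousLinearMap.ext fun x => LinearMap.congr_fun hM x⟩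

theorem Matrix.eq_of_mulVec_eq {M N : Matrix (Fin m) (Fin n) ℂ} (h : ∀ x, M *ᵥ x = N *ᵥ x) :
    M = N :=
  mulVec_injective (funext h)

theorem EuclideanSpace.inner_eq (x y : EuclideanSpace ℂ (Fin n)) :
    ⟪x, y⟫_ℂ = star x.ofLp ⬝ᵥ y.ofLp := by
  rw [EuclideanSpace.inner_eq_star_dotProduct, dotProduct_comm]

theorem Matrix.IsSchur.summable_norm_euclCLM_pow {Φ : Matrix (Fin n) (Fin n) ℂ}
    (hΦ : Φ.IsSchur) : Summable fun k : ℕ => ‖Φ.euclCLM ^ k‖ := by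
  refine summable_norm_pow_of_isUnit fun q hq => ?_
  have h1 : q • (1 : EuclideanSpace ℂ (Fin n) →L[ℂ] EuclideanSpace ℂ (Fin n)) - Φ.euclCLM =
      toEuclideanCLM (n := Fin n) (𝕜 := ℂ) (q • 1 - Φ) := by
    rw [map_sub, map_smul, map_one]
    rfl
  rw [h1]
  exact (hΦ q hq).map _

theorem Matrix.PosDef.of_re_pos {M : Matrix (Fin n) (Fin n) ℂ} (hM : M.IsHermitian)
    (h : ∀ x, x ≠ 0 → 0 < (star x ⬝ᵥ (M *ᵥ x)).re) : M.PosDef := by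
  refine PosDef.of_dotProduct_mulVec_pos hM fun x hx => ?_
  exact Complex.pos_iff.2 ⟨h x hx, (hM.im_star_dotProduct_mulVec_self x).symm⟩

open scoped MatrixOrder in
theorem Matrix.PosSemidef.exists_conjTranspose_mul_self {M : Matrix (Fin n) (Fin n) ℂ}
    (hM : M.PosSemidef) : ∃ N : Matrix (Fin n) (Fin n) ℂ, M = Nᴴ * N :=
  CStarAlgebra.nonneg_iff_eq_star_mul_self.mp hM.nonneg

/-- A stable realization with nonnegative Pick form has a stabilizing solution of the discrete
algebraic Riccati equation, for every margin `ε > 0`. -/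
theorem Realization.exists_riccati {G : Realization (Fin n) (Fin m) (Fin m)} (hA : G.A.IsSchur)
    (hPick : ∀ (F : Finset {z : ℂ // 0 < ‖z‖ ∧ ‖z‖ < 1})
      (u : {z : ℂ // 0 < ‖z‖ ∧ ‖z‖ < 1} → Fin m → ℂ),
      0 ≤ (∑ z ∈ F, ∑ w ∈ F, (star (u z) ⬝ᵥ (G.transfer (w : ℂ)⁻¹ *ᵥ u w)) /
        (1 - (starRingEnd ℂ) (z : ℂ) * w)).re) {ε : ℝ} (hε : 0 < ε) :
    ∃ (Sig : Matrix (Fin n) (Fin n) ℂ) (K : Matrix (Fin m) (Fin n) ℂ),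
      Sig.PosSemidef ∧
      (G.D + G.Dᴴ + (ε : ℂ) • (1 : Matrix (Fin m) (Fin m) ℂ) - G.Bᴴ * Sig * G.B).PosDef ∧
      (G.D + G.Dᴴ + (ε : ℂ) • (1 : Matrix (Fin m) (Fin m) ℂ) - G.Bᴴ * Sig * G.B) * K =
        G.Bᴴ * Sig * G.A - G.C ∧
      Sig = G.Aᴴ * Sig * G.A + (G.Aᴴ * Sig * G.B - G.Cᴴ) * K ∧
      (G.A + G.B * K).IsSchur := by
  obtain ⟨P, L, hP, hR, hRK, hric, hstab⟩ := exists_riccati_of_pick hA.summable_norm_euclCLM_pow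
    G.B.euclCLM G.C.euclCLM G.D.euclCLM (fun F u x hx => by
      refine (hPick F fun z => (u z).ofLp).trans_eq ?_
      congr 1
      refine Finset.sum_congr rfl fun z _ => Finset.sum_congr rfl fun w _ => ?_
      rw [EuclideanSpace.inner_eq]
      congr 2
      have hw : (w : ℂ) ≠ 0 := norm_pos_iff.1 w.2.1
      have hU : IsUnit ((w : ℂ)⁻¹ • (1 : Matrix (Fin n) (Fin n) ℂ) - G.A) :=
        hA _ (by rw [norm_inv]; exact (one_le_inv₀ w.2.1).2 w.2.2.le)
      have h1 : ((w : ℂ)⁻¹ • (1 : Matrix (Fin n) (Fin n) ℂ) - G.A) *ᵥ (x w).ofLp =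
          G.B *ᵥ (u w).ofLp := by
        have h2 : (x w).ofLp = (w : ℂ) • (G.A *ᵥ (x w).ofLp + G.B *ᵥ (u w).ofLp) :=
          congrArg WithLp.ofLp (hx w)
        rw [sub_mulVec, smul_mulVec, one_mulVec]
        conv_lhs => enter [1, 2]; rw [h2]
        rw [smul_smul, inv_mul_cancel₀ hw, one_smul, add_sub_cancel_left]
      have h3 : (x w).ofLp =
          ((w : ℂ)⁻¹ • (1 : Matrix (Fin n) (Fin n) ℂ) - G.A)⁻¹ *ᵥ (G.B *ᵥ (u w).ofLp) := by
        rw [← h1, mulVec_mulVec, nonsing_inv_mul _ ((isUnit_iff_isUnit_det _).1 hU), one_mulVec]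
      change _ = G.D *ᵥ (u w).ofLp + G.C *ᵥ (x w).ofLp
      rw [h3, transfer, add_mulVec, mulVec_mulVec, mulVec_mulVec, add_comm, Matrix.mul_assoc]) hε
  obtain ⟨Sig, rfl⟩ := exists_euclCLM_eq P
  obtain ⟨K, rfl⟩ := exists_euclCLM_eq L
  simp only [adjoint_euclCLM] at hR hRK hric
  have hSig : Sig.PosSemidef := isPositive_toEuclideanLin_iff.1 hP.toLinearMap
  refine ⟨Sig, K, hSig, PosDef.of_re_pos ?_ fun x hx => ?_, ?_, ?_, fun q hq => ?_⟩
  · rw [IsHermitian]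
    simp only [conjTranspose_add, conjTranspose_sub, conjTranspose_mul, conjTranspose_smul,
      conjTranspose_conjTranspose, conjTranspose_one, hSig.1.eq, Matrix.mul_assoc,
      Complex.star_def, Complex.conj_ofReal]
    abel
  · refine lt_of_lt_of_le ?_ ((hR (WithLp.toLp 2 x)).trans_eq ?_)
    · have : WithLp.toLp 2 x ≠ 0 := fun h => hx (congrArg WithLp.ofLp h)
      have := norm_pos_iff.2 this
      positivity
    · rw [EuclideanSpace.inner_eq]
      change (star x ⬝ᵥ (G.D *ᵥ x + G.Dᴴ *ᵥ x + (ε : ℂ) • x -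
        G.Bᴴ *ᵥ (Sig *ᵥ (G.B *ᵥ x)))).re = _
      simp only [sub_mulVec, add_mulVec, smul_mulVec, one_mulVec, mulVec_mulVec, Matrix.mul_assoc]
  · refine eq_of_mulVec_eq fun x => ?_
    have h : G.D *ᵥ (K *ᵥ x) + G.Dᴴ *ᵥ (K *ᵥ x) + (ε : ℂ) • (K *ᵥ x) -
        G.Bᴴ *ᵥ (Sig *ᵥ (G.B *ᵥ (K *ᵥ x))) = G.Bᴴ *ᵥ (Sig *ᵥ (G.A *ᵥ x)) - G.C *ᵥ x :=
      congrArg WithLp.ofLp (hRK (WithLp.toLp 2 x))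
    rw [← mulVec_mulVec]
    simp only [sub_mulVec, add_mulVec, smul_mulVec, one_mulVec, ← mulVec_mulVec]
    exact h
  · refine eq_of_mulVec_eq fun x => ?_
    have h : Sig *ᵥ x = G.Aᴴ *ᵥ (Sig *ᵥ (G.A *ᵥ x)) +
        (G.Aᴴ *ᵥ (Sig *ᵥ (G.B *ᵥ (K *ᵥ x))) - G.Cᴴ *ᵥ (K *ᵥ x)) :=
      congrArg WithLp.ofLp (hric (WithLp.toLp 2 x))
    simp only [sub_mulVec, add_mulVec, ← mulVec_mulVec]
    exact h
  · refine isUnit_of_forall_mulVec fun x hx => ?_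
    have h1 : G.A *ᵥ x + G.B *ᵥ (K *ᵥ x) = q • x := by
      rw [sub_mulVec, smul_mulVec, one_mulVec, add_mulVec, ← mulVec_mulVec] at hx
      exact (sub_eq_zero.1 hx).symm
    -- An eigenvector of the closed loop outside the open disc has `K x = 0`, hence is an
    -- eigenvector of `A`, contradicting stability unless it is zero.
    have h2 : K *ᵥ x = 0 :=
      congrArg WithLp.ofLp (hstab (WithLp.toLp 2 x) q hq (congrArg (WithLp.toLp 2) h1))
    rw [h2, mulVec_zero, add_zero] at h1
    have h3 : (q • (1 : Matrix (Fin n) (Fin n) ℂ) - G.A) *ᵥ x = 0 := by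
      rw [sub_mulVec, smul_mulVec, one_mulVec, h1, sub_self]
    have h4 := congrArg (fun v => (q • (1 : Matrix (Fin n) (Fin n) ℂ) - G.A)⁻¹ *ᵥ v) h3
    simpa [mulVec_mulVec, nonsing_inv_mul _ ((isUnit_iff_isUnit_det _).1 (hA q hq))] using h4

end Riccati

/-! ### The discrete Pick form and existence of the spectral factor. -/

namespace Plant

variable {nP nw nu nz : ℕ} {P : Plant nP nw nu nz}

theorem discrete_pick_nonneg (hmin : P.toRealization.IsMinimal) (hgain : P.HasBoundedGain)
    (hpass : P.IsPassive) {τ : ℝ} (hτ : 0 < τ) (F : Finset {z : ℂ // 0 < ‖z‖ ∧ ‖z‖ < 1})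
    (u : {z : ℂ // 0 < ‖z‖ ∧ ‖z‖ < 1} → Fin nu → ℂ) :
    0 ≤ (∑ z ∈ F, ∑ w ∈ F,
      (star (u z) ⬝ᵥ ((P.tildeRealization τ).transfer (w : ℂ)⁻¹ *ᵥ u w)) /
        (1 - (starRingEnd ℂ) (z : ℂ) * w)).re := by
  have hτ' : (τ : ℂ) ≠ 0 := by exact_mod_cast hτ.ne'
  have hne : ∀ z : {z : ℂ // 0 < ‖z‖ ∧ ‖z‖ < 1}, (z : ℂ) ≠ 0 := fun z => norm_pos_iff.1 z.2.1
  have hne1 : ∀ z : {z : ℂ // 0 < ‖z‖ ∧ ‖z‖ < 1}, 1 + (z : ℂ) ≠ 0 := fun z h => by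
    have := z.2.2
    rw [eq_neg_of_add_eq_zero_right h, norm_neg, norm_one] at this
    exact lt_irrefl _ this
  let s : {z : ℂ // 0 < ‖z‖ ∧ ‖z‖ < 1} → ℂ := fun z =>
    1 / (2 * (τ : ℂ)) * (((z : ℂ)⁻¹ - 1) / ((z : ℂ)⁻¹ + 1))
  have hs : ∀ z, s z = 1 / (2 * (τ : ℂ)) * ((1 - z) / (1 + z)) := fun z => by
    have h1 := hne z
    have h2 := hne1 z
    have h3 : (z : ℂ)⁻¹ + 1 ≠ 0 := fun h => h2 (by
      rw [← mul_inv_cancel₀ h1, ← mul_one (z : ℂ), mul_assoc, one_mul, mul_one]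
      linear_combination (z : ℂ) * h)
    simp only [s]
    congr 1
    rw [div_eq_div_iff h3 h2]
    field_simp
  -- The Cayley transform multiplies the kernel by `τ (1 + z̄)(1 + w)`; the last two factors are
  -- absorbed by rescaling the vectors `u`.
  have hsum : ∀ z w, (starRingEnd ℂ) (s z) + s w =
      (1 - (starRingEnd ℂ) (z : ℂ) * w) / (τ * (1 + (starRingEnd ℂ) (z : ℂ)) * (1 + w)) := by
    intro z w
    have h1 := hne1 w
    have h2 : 1 + (starRingEnd ℂ) (z : ℂ) ≠ 0 := fun h => hne1 z (by
      have := congrArg (starRingEnd ℂ) h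
      simpa using this)
    rw [hs, hs]
    simp only [map_mul, map_div₀, map_one, map_sub, map_add, Complex.conj_ofReal, map_ofNat]
    field_simp
    ring
  have hre : ∀ z, 0 < (s z).re := fun z => by
    have h1 : ((s z).re : ℂ) * 2 = ((1 - ‖(z : ℂ)‖ ^ 2) / (τ * ‖1 + (z : ℂ)‖ ^ 2) : ℝ) := by
      have h2 := hsum z z
      rw [add_comm, Complex.add_conj] at h2
      rw [mul_comm]
      push_cast at h2 ⊢
      rw [h2, ← Complex.conj_mul' (z : ℂ), ← Complex.conj_mul' (1 + (z : ℂ)), map_add, map_one,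
        mul_assoc]
    have h3 : (s z).re * 2 = (1 - ‖(z : ℂ)‖ ^ 2) / (τ * ‖1 + (z : ℂ)‖ ^ 2) := by
      exact_mod_cast h1
    have h4 : 0 < 1 - ‖(z : ℂ)‖ ^ 2 := by nlinarith [z.2.1, z.2.2]
    have h5 := norm_pos_iff.2 (hne1 z)
    have h6 : 0 < (s z).re * 2 := by rw [h3]; positivity
    linarith
  have key := pick_nonneg hmin hgain hpass F s hre fun z => (1 + (z : ℂ))⁻¹ • u z
  have heq : (∑ z ∈ F, ∑ w ∈ F, (star ((1 + (z : ℂ))⁻¹ • u z) ⬝ᵥ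
      (P.hatPuy (s w) *ᵥ ((1 + (w : ℂ))⁻¹ • u w))) / ((starRingEnd ℂ) (s z) + s w)) =
      (τ : ℂ) * ∑ z ∈ F, ∑ w ∈ F,
        (star (u z) ⬝ᵥ ((P.tildeRealization τ).transfer (w : ℂ)⁻¹ *ᵥ u w)) /
          (1 - (starRingEnd ℂ) (z : ℂ) * w) := by
    rw [Finset.mul_sum]
    refine Finset.sum_congr rfl fun z _ => ?_
    rw [Finset.mul_sum]
    refine Finset.sum_congr rfl fun w _ => ?_
    have h1 := hne1 w
    have h2 : 1 + (starRingEnd ℂ) (z : ℂ) ≠ 0 := fun h => hne1 z (by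
      have := congrArg (starRingEnd ℂ) h
      simpa using this)
    have hw1 : (1 : ℝ) < ‖(w : ℂ)⁻¹‖ := by rw [norm_inv]; exact (one_lt_inv₀ w.2.1).2 w.2.2
    have h3 : P.hatPuy (s w) = (P.tildeRealization τ).transfer (w : ℂ)⁻¹ :=
      tildePuy_eq hτ (isUnit_one_sub_smul_A hmin hgain hτ)
        (fun h => by rw [h, norm_neg, norm_one] at hw1; exact lt_irrefl _ hw1)
        (isSchur_Phi hmin hgain hτ _ hw1.le)
    rw [h3, hsum, star_smul, smul_dotProduct, mulVec_smul, dotProduct_smul, smul_eq_mul,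
      smul_eq_mul, Complex.star_def, map_inv₀, map_add, map_one, div_div_eq_mul_div]
    rw [← mul_div_assoc]
    congr 1
    field_simp
  rw [heq, Complex.re_ofReal_mul] at key
  exact nonneg_of_mul_nonneg_right key hτ

/-- Factor the Riccati weight as `NᴴN` and take `Δ_S = N`, `Π_S = -N K`. Then `Φ_F` is the
closed-loop matrix `Φ + Γ_u K`, so stabilization is exactly stability of the inverse factor. -/
theorem exists_isPRFactorization (hmin : P.toRealization.IsMinimal) (hgain : P.HasBoundedGain)
    (hpass : P.IsPassive) {ε τ : ℝ} (hε : 0 < ε) (hτ : 0 < τ) :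
    ∃ (SigP : Matrix (Fin nP) (Fin nP) ℂ) (PiS : Matrix (Fin nu) (Fin nP) ℂ)
      (DelS : Matrix (Fin nu) (Fin nu) ℂ), P.IsPRFactorization ε τ SigP PiS DelS ∧
        IsHInftyUnit (P.spectralFactor τ PiS DelS).transfer := by
  have hΦ := isSchur_Phi hmin hgain hτ
  obtain ⟨Sig, K, hSig, hR, hRK, hric, hF⟩ := (P.tildeRealization τ).exists_riccati hΦ
    (discrete_pick_nonneg hmin hgain hpass hτ) hε
  simp only [tildeRealization] at hR hRK hric hF
  obtain ⟨N, hN⟩ := hR.posSemidef.exists_conjTranspose_mul_self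
  have hNu : IsUnit N := by
    have h1 := hR.isUnit
    rw [hN, isUnit_iff_isUnit_det, det_mul, IsUnit.mul_iff] at h1
    exact (isUnit_iff_isUnit_det _).2 h1.2
  have hRKc : (P.Phi τ)ᴴ * Sig * P.GammaU τ - (P.PiY τ)ᴴ = Kᴴ * (Nᴴ * N) := by
    have h1 := congrArg conjTranspose hRK
    rw [hN] at h1
    simp only [conjTranspose_mul, conjTranspose_sub, conjTranspose_conjTranspose, hSig.1.eq,
      Matrix.mul_assoc] at h1 ⊢
    exact h1.symm
  rw [hN] at hRK
  refine ⟨Sig, -(N * K), N, ⟨hSig, ?_⟩, Realization.isHInftyUnit_transfer hNu hΦ ?_⟩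
  · rw [fromRows_mul_fromCols, fromBlocks_neg]
    congr 1
    · rw [hRKc] at hric
      rw [conjTranspose_neg, Matrix.neg_mul, Matrix.mul_neg, neg_neg, conjTranspose_mul]
      conv_lhs => rw [hric]
      have : (P.Phi τ)ᴴ * Sig * P.Phi τ = Sig - Kᴴ * (Nᴴ * N) * K := by
        conv_rhs => enter [1]; rw [hric]
        abel
      rw [← hric, this]
      simp only [Matrix.mul_assoc]
      abel
    · rw [hRKc, conjTranspose_neg, Matrix.neg_mul, neg_neg, conjTranspose_mul, Matrix.mul_assoc]
    · rw [← hRK, Matrix.mul_neg, neg_neg, Matrix.mul_assoc]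
    · rw [← hN]
      abel
  · have h1 : (P.spectralFactor τ (-(N * K)) N).PhiF = P.Phi τ + P.GammaU τ * K := by
      rw [Realization.PhiF, spectralFactor]
      simp only [Matrix.mul_neg, sub_neg_eq_add]
      rw [Matrix.mul_assoc, ← Matrix.mul_assoc N⁻¹,
        nonsing_inv_mul _ ((isUnit_iff_isUnit_det _).1 hNu), Matrix.one_mul]
    rw [h1]
    exact hF

end Plant

/-! ### Feedthrough and zeros of an admissible spectral factor. -/

namespace Realization

variable {n m : ℕ} {S : Realization (Fin n) (Fin m) (Fin m)}

/-- The direct feedthrough of a unit of `H∞` is invertible. -/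
theorem isUnit_D_of_isHInftyUnit (hS : IsHInftyUnit S.transfer) : IsUnit S.D := by
  obtain ⟨-, hU, -, M, hM⟩ := hS
  refine isUnit_of_forall_mulVec fun v hv => funext fun i => ?_
  -- A vector killed by `D` is asymptotically killed by the transfer function at infinity, and
  -- boundedness of the inverse forces it to vanish.
  have hb : ∀ᶠ q in Bornology.cobounded ℂ,
      ‖v i‖ ≤ ∑ j, M * ‖∑ k, S.transfer q j k * v k‖ := by
    have h1 : ∀ᶠ q : ℂ in Bornology.cobounded ℂ, 1 < ‖q‖ :=
      tendsto_norm_cobounded_atTop.eventually (Filter.eventually_gt_atTop 1)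
    filter_upwards [h1] with q hq
    have h2 : v = (S.transfer q)⁻¹ *ᵥ (S.transfer q *ᵥ v) := by
      rw [mulVec_mulVec, nonsing_inv_mul _ ((isUnit_iff_isUnit_det _).1 (hU q hq)), one_mulVec]
    conv_lhs => rw [h2]
    rw [mulVec, dotProduct]
    refine (norm_sum_le _ _).trans (Finset.sum_le_sum fun j _ => ?_)
    rw [norm_mul]
    exact mul_le_mul_of_nonneg_right (hM q hq i j) (norm_nonneg _)
  have ht : Filter.Tendsto (fun q => ∑ j, M * ‖∑ k, S.transfer q j k * v k‖)
      (Bornology.cobounded ℂ) (nhds (∑ j, M * ‖∑ k, S.D j k * v k‖)) :=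
    tendsto_finsetSum _ fun j _ => ((tendsto_finsetSum _ fun k _ =>
      (S.tendsto_transfer j k).mul_const (v k)).norm).const_mul M
  have h0 : ∑ j, M * ‖∑ k, S.D j k * v k‖ = 0 := Finset.sum_eq_zero fun j _ => by
    rw [show ∑ k, S.D j k * v k = 0 from congrFun hv j, norm_zero, mul_zero]
  rw [h0] at ht
  exact norm_le_zero_iff.1 (ge_of_tendsto ht hb)

/-- The zeros of a stable unit of `H∞` lie in the open unit disc. -/
theorem isSchur_PhiF (hA : S.A.IsSchur) (hS : IsHInftyUnit S.transfer) : S.PhiF.IsSchur := by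
  have hD := (isUnit_iff_isUnit_det _).1 (isUnit_D_of_isHInftyUnit hS)
  obtain ⟨-, hU, -, M, hM⟩ := hS
  intro μ hμ
  refine isUnit_of_forall_mulVec fun x hx => ?_
  -- For `Φ_F x = μ x` this is the zero direction: `S(q) v = (q - μ) C (q - A)⁻¹ x`.
  obtain ⟨v, hv⟩ : ∃ v, v = S.D⁻¹ *ᵥ (S.C *ᵥ x) := ⟨_, rfl⟩
  have hDv : S.D *ᵥ v = S.C *ᵥ x := by
    rw [hv, mulVec_mulVec, mul_nonsing_inv _ hD, one_mulVec]
  have hAx : (μ • (1 : Matrix (Fin n) (Fin n) ℂ) - S.A) *ᵥ x = -(S.B *ᵥ v) := by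
    have h1 : (μ • (1 : Matrix (Fin n) (Fin n) ℂ) - S.A) *ᵥ x + S.B *ᵥ v = 0 := by
      rw [← hx, hv, PhiF]
      simp only [sub_mulVec, mulVec_mulVec, Matrix.mul_assoc]
      abel
    exact eq_neg_of_add_eq_zero_left h1
  -- An auxiliary single-input system with transfer function `C (q - A)⁻¹ x`, introduced to bound
  -- that factor uniformly.
  let R : Realization (Fin n) (Fin 1) (Fin m) := ⟨S.A, of fun i _ => x i, S.C, 0⟩
  obtain ⟨-, M', hM'⟩ := isHInfty_transfer (G := R) hA
  have hRt : ∀ q j, R.transfer q j 0 =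
      (S.C *ᵥ ((q • (1 : Matrix (Fin n) (Fin n) ℂ) - S.A)⁻¹ *ᵥ x)) j := fun q j => by
    rw [mulVec_mulVec, transfer]
    exact add_zero _
  have hSv : ∀ q : ℂ, 1 < ‖q‖ → S.transfer q *ᵥ v =
      (q - μ) • (S.C *ᵥ ((q • (1 : Matrix (Fin n) (Fin n) ℂ) - S.A)⁻¹ *ᵥ x)) := fun q hq => by
    have h1 : (q • (1 : Matrix (Fin n) (Fin n) ℂ) - S.A) *ᵥ x = (q - μ) • x - S.B *ᵥ v := by
      rw [sub_eq_add_neg _ (S.B *ᵥ v), ← hAx]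
      simp only [sub_mulVec, smul_mulVec, one_mulVec, sub_smul]
      abel
    have h2 := congrArg (fun y => (q • (1 : Matrix (Fin n) (Fin n) ℂ) - S.A)⁻¹ *ᵥ y) h1
    simp only [mulVec_mulVec, nonsing_inv_mul _ ((isUnit_iff_isUnit_det _).1 (hA q hq.le)),
      one_mulVec, mulVec_sub, mulVec_smul] at h2
    have h3 := congrArg (fun y => S.C *ᵥ y) h2
    simp only [mulVec_sub, mulVec_smul, mulVec_mulVec] at h3
    rw [transfer, add_mulVec, hDv, h3, mulVec_mulVec, Matrix.mul_assoc]
    abel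
  have hv0 : v = 0 := funext fun i => by
    -- Radial approach `q = tμ`, `t ↓ 1`, stays outside the closed disc and so also covers `|μ| =
    -- 1`.
    have hb : ∀ᶠ t : ℝ in nhdsWithin 1 (Set.Ioi 1),
        ‖v i‖ ≤ (t - 1) * ‖μ‖ * ∑ j : Fin m, |M| * |M'| := by
      filter_upwards [self_mem_nhdsWithin] with t ht
      have ht1 : (1 : ℝ) < t := ht
      have hn : ‖(t : ℂ) * μ‖ = t * ‖μ‖ := by
        rw [norm_mul, Complex.norm_real, Real.norm_of_nonneg (by linarith)]
      have hq : 1 < ‖(t : ℂ) * μ‖ := by rw [hn]; nlinarith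
      have h2 : v = (S.transfer (t * μ))⁻¹ *ᵥ (S.transfer (t * μ) *ᵥ v) := by
        rw [mulVec_mulVec, nonsing_inv_mul _ ((isUnit_iff_isUnit_det _).1 (hU _ hq)), one_mulVec]
      have hd : ‖(t : ℂ) * μ - μ‖ = (t - 1) * ‖μ‖ := by
        rw [← sub_one_mul, norm_mul, ← Complex.ofReal_one, ← Complex.ofReal_sub, Complex.norm_real,
          Real.norm_of_nonneg (by linarith)]
      rw [hSv _ hq, mulVec_smul] at h2
      rw [h2, Pi.smul_apply, norm_smul, hd]
      refine mul_le_mul_of_nonneg_left ?_ (mul_nonneg (by linarith) (norm_nonneg _))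
      rw [mulVec, dotProduct]
      refine (norm_sum_le _ _).trans (Finset.sum_le_sum fun j _ => ?_)
      rw [norm_mul, ← hRt]
      exact mul_le_mul ((hM _ hq i j).trans (le_abs_self _))
        ((hM' _ hq j 0).trans (le_abs_self _)) (norm_nonneg _) (abs_nonneg _)
    have ht : Filter.Tendsto (fun t : ℝ => (t - 1) * ‖μ‖ * ∑ j : Fin m, |M| * |M'|)
        (nhdsWithin 1 (Set.Ioi 1)) (nhds 0) := by
      have : Continuous fun t : ℝ => (t - 1) * ‖μ‖ * ∑ j : Fin m, |M| * |M'| := by fun_prop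
      simpa using (this.tendsto 1).mono_left nhdsWithin_le_nhds
    exact norm_le_zero_iff.1 (ge_of_tendsto ht hb)
  rw [hv0, mulVec_zero, neg_zero] at hAx
  have h4 := congrArg (fun y => (μ • (1 : Matrix (Fin n) (Fin n) ℂ) - S.A)⁻¹ *ᵥ y) hAx
  simpa [mulVec_mulVec, nonsing_inv_mul _ ((isUnit_iff_isUnit_det _).1 (hA μ hμ))] using h4

end Realization

/-! ### The Stein equation. -/

section Stein

variable {n : ℕ} {M : Matrix (Fin n) (Fin n) ℂ}

theorem Matrix.IsSchur.tendsto_pow_mul (hM : M.IsSchur) (X : Matrix (Fin n) (Fin n) ℂ) :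
    Filter.Tendsto (fun k : ℕ => M ^ k * X * (M ^ k)ᴴ) Filter.atTop (nhds 0) := by
  have hc : Continuous fun N : Matrix (Fin n) (Fin n) ℂ => N * X * Nᴴ := by fun_prop
  have h := (hc.tendsto 0).comp hM.tendsto_pow
  rw [Matrix.zero_mul, Matrix.zero_mul] at h
  exact h

theorem Matrix.IsSchur.eq_zero_of_eq_mul (hM : M.IsSchur) {X : Matrix (Fin n) (Fin n) ℂ}
    (hX : X = M * X * Mᴴ) : X = 0 := by
  have h1 : ∀ k : ℕ, M ^ k * X * (M ^ k)ᴴ = X := fun k => by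
    induction k with
    | zero => simp
    | succ k ih =>
      conv_rhs => rw [← ih, hX]
      rw [pow_succ, conjTranspose_mul]
      simp only [Matrix.mul_assoc]
  have h2 := hM.tendsto_pow_mul X
  simp only [h1] at h2
  exact tendsto_nhds_unique tendsto_const_nhds h2

/-- The map `X ↦ X - M X Mᴴ` is injective, hence surjective in finite dimension. -/
theorem Matrix.IsSchur.exists_stein (hM : M.IsSchur) (Q : Matrix (Fin n) (Fin n) ℂ) :
    ∃ X, X = M * X * Mᴴ + Q := by
  let L : Matrix (Fin n) (Fin n) ℂ →ₗ[ℂ] Matrix (Fin n) (Fin n) ℂ :=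
    { toFun := fun X => X - M * X * Mᴴ
      map_add' := fun X Y => by rw [Matrix.mul_add, Matrix.add_mul]; abel
      map_smul' := fun c X => by
        rw [Matrix.mul_smul, Matrix.smul_mul, RingHom.id_apply, smul_sub] }
  have hL : Function.Injective L := by
    rw [← LinearMap.ker_eq_bot, LinearMap.ker_eq_bot']
    exact fun X hX => hM.eq_zero_of_eq_mul (sub_eq_zero.1 hX)
  obtain ⟨X, hX⟩ := LinearMap.injective_iff_surjective.1 hL Q
  exact ⟨X, by rw [← hX]; exact (add_sub_cancel _ _).symm⟩

theorem Matrix.IsSchur.stein_unique (hM : M.IsSchur) {Q X Y : Matrix (Fin n) (Fin n) ℂ}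
    (hX : X = M * X * Mᴴ + Q) (hY : Y = M * Y * Mᴴ + Q) : X = Y := by
  refine sub_eq_zero.1 (hM.eq_zero_of_eq_mul ?_)
  conv_lhs => rw [hX, hY]
  rw [Matrix.mul_sub, Matrix.sub_mul]
  abel

theorem Matrix.IsSchur.stein_isHermitian (hM : M.IsSchur) {Q X : Matrix (Fin n) (Fin n) ℂ}
    (hQ : Q.IsHermitian) (hX : X = M * X * Mᴴ + Q) : X.IsHermitian := by
  refine hM.stein_unique (Q := Q) ?_ hX
  conv_lhs => rw [hX]
  rw [conjTranspose_add, conjTranspose_mul, conjTranspose_mul, conjTranspose_conjTranspose, hQ.eq,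
    Matrix.mul_assoc]

/-- `X - Mᵏ X (Mᵏ)ᴴ` is a sum of terms `Mⁱ Q (Mⁱ)ᴴ` and tends to `X`. Positivity of `Σ_F` is what
later makes the additive factor invertible. -/
theorem Matrix.IsSchur.stein_posSemidef (hM : M.IsSchur) {Q X : Matrix (Fin n) (Fin n) ℂ}
    (hQ : Q.PosSemidef) (hX : X = M * X * Mᴴ + Q) : X.PosSemidef := by
  have hX' : X.IsHermitian := hM.stein_isHermitian hQ.1 hX
  have h1 : ∀ k : ℕ, (X - M ^ k * X * (M ^ k)ᴴ).PosSemidef := fun k => by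
    induction k with
    | zero => simpa using PosSemidef.zero
    | succ k ih =>
      have h2 : X - M ^ (k + 1) * X * (M ^ (k + 1))ᴴ =
          (X - M ^ k * X * (M ^ k)ᴴ) + M ^ k * Q * (M ^ k)ᴴ := by
        have h3 : Q = X - M * X * Mᴴ := eq_sub_of_add_eq' hX.symm
        rw [h3, pow_succ, conjTranspose_mul, Matrix.mul_sub, Matrix.sub_mul]
        simp only [Matrix.mul_assoc]
        abel
      rw [h2]
      exact ih.add (hQ.mul_mul_conjTranspose_same _)
  refine PosSemidef.of_dotProduct_mulVec_nonneg hX' fun x => ?_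
  refine Complex.nonneg_iff.2 ⟨?_, (hX'.im_star_dotProduct_mulVec_self x).symm⟩
  have hc : Continuous fun N : Matrix (Fin n) (Fin n) ℂ => (star x ⬝ᵥ ((X - N) *ᵥ x)).re := by
    fun_prop
  have ht := (hc.tendsto 0).comp (hM.tendsto_pow_mul X)
  rw [sub_zero] at ht
  exact ge_of_tendsto' ht fun k => (Complex.nonneg_iff.1 ((h1 k).dotProduct_mulVec_nonneg x)).1

end Stein

/-! ### The additive factor. -/

namespace Realization

variable {n m : ℕ} {S : Realization (Fin n) (Fin m) (Fin m)}

/-- The additive factor splits the para-Hermitian form `S⁻¹ S^{-∼}`, up to a term that vanishes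
for reflected points. -/
theorem additiveFactor_add {Sig : Matrix (Fin n) (Fin n) ℂ} (hSig : Sig.IsHermitian)
    (hStein : S.SteinEq Sig) {p q : ℂ}
    (hp : IsUnit (p • (1 : Matrix (Fin n) (Fin n) ℂ) - S.PhiF))
    (hq : IsUnit (q • (1 : Matrix (Fin n) (Fin n) ℂ) - S.PhiF)) :
    (S.additiveFactor Sig).transfer q + ((S.additiveFactor Sig).transfer p)ᴴ =
      S.inverse.transfer q * (S.inverse.transfer p)ᴴ + (q * star p - 1) •
        (S.D⁻¹ * S.C * (q • (1 : Matrix (Fin n) (Fin n) ℂ) - S.PhiF)⁻¹ * Sig *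
          (S.D⁻¹ * S.C * (p • (1 : Matrix (Fin n) (Fin n) ℂ) - S.PhiF)⁻¹)ᴴ) := by
  -- Each summand is written as `X (…) Yᴴ` with `X`, `Y` the resolvents at `q`, `p`; the middle
  -- factors then add up to the Stein expression plus the multiple `q p̄ - 1` of `Σ_F`.
  have key : ∀ X Y : Matrix (Fin n) (Fin n) ℂ,
      X * (q • (1 : Matrix (Fin n) (Fin n) ℂ) - S.PhiF) = 1 →
      (p • (1 : Matrix (Fin n) (Fin n) ℂ) - S.PhiF)ᴴ * Yᴴ = 1 →
      X * S.PhiF * Sig + Sig * S.PhiFᴴ * Yᴴ + Sig =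
        X * (Sig - S.PhiF * Sig * S.PhiFᴴ) * Yᴴ + (q * star p - 1) • (X * Sig * Yᴴ) := by
    intro X Y hX hY
    have e1 : X * S.PhiF * Sig = X * (S.PhiF * Sig *
        (p • (1 : Matrix (Fin n) (Fin n) ℂ) - S.PhiF)ᴴ) * Yᴴ := by
      rw [Matrix.mul_assoc X (S.PhiF * Sig * _), Matrix.mul_assoc (S.PhiF * Sig), hY,
        Matrix.mul_one, Matrix.mul_assoc]
    have e2 : Sig * S.PhiFᴴ * Yᴴ = X * ((q • (1 : Matrix (Fin n) (Fin n) ℂ) - S.PhiF) *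
        (Sig * S.PhiFᴴ)) * Yᴴ := by
      rw [← Matrix.mul_assoc X, hX, Matrix.one_mul]
    have e3 : Sig = X * ((q • (1 : Matrix (Fin n) (Fin n) ℂ) - S.PhiF) * Sig *
        (p • (1 : Matrix (Fin n) (Fin n) ℂ) - S.PhiF)ᴴ) * Yᴴ := by
      rw [← Matrix.mul_assoc X, ← Matrix.mul_assoc X, hX, Matrix.one_mul, Matrix.mul_assoc, hY,
        Matrix.mul_one]
    conv_lhs => rw [e1, e2]; enter [2]; rw [e3]
    simp only [conjTranspose_sub, conjTranspose_smul, conjTranspose_one, Matrix.mul_sub,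
      Matrix.sub_mul, Matrix.mul_smul, Matrix.smul_mul, Matrix.mul_one, Matrix.one_mul,
      Matrix.mul_assoc, smul_sub, sub_smul, smul_smul, one_smul]
    rw [mul_comm q (star p)]
    abel
  have hk := key (q • 1 - S.PhiF)⁻¹ (p • 1 - S.PhiF)⁻¹
    (nonsing_inv_mul _ ((isUnit_iff_isUnit_det _).1 hq)) (by
      rw [← conjTranspose_mul, nonsing_inv_mul _ ((isUnit_iff_isUnit_det _).1 hp),
        conjTranspose_one])
  have hbb : Sig - S.PhiF * Sig * S.PhiFᴴ = S.B * S.D⁻¹ * (S.D⁻¹)ᴴ * S.Bᴴ := by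
    have h1 : Sig = S.PhiF * Sig * S.PhiFᴴ + S.B * S.D⁻¹ * (S.D⁻¹)ᴴ * S.Bᴴ := hStein
    exact sub_eq_of_eq_add' h1
  rw [hbb] at hk
  simp only [transfer, additiveFactor, inverse]
  generalize (q • (1 : Matrix (Fin n) (Fin n) ℂ) - S.PhiF)⁻¹ = X at *
  generalize (p • (1 : Matrix (Fin n) (Fin n) ℂ) - S.PhiF)⁻¹ = Y at *
  generalize S.PhiF = N at *
  generalize S.D⁻¹ = d at *
  have hk' := congrArg (fun Z => d * S.C * Z * (d * S.C)ᴴ) hk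
  simp only [Matrix.mul_add, Matrix.add_mul, Matrix.mul_smul, Matrix.smul_mul,
    conjTranspose_mul, Matrix.mul_assoc] at hk'
  simp only [conjTranspose_mul, conjTranspose_add, conjTranspose_sub, conjTranspose_neg,
    conjTranspose_smul, conjTranspose_conjTranspose, hSig.eq, Matrix.mul_add,
    Matrix.add_mul, Matrix.mul_sub, Matrix.sub_mul, Matrix.neg_mul, Matrix.mul_neg,
    Matrix.mul_assoc, Matrix.mul_one, smul_add]
  have hhalf : star (1 / 2 : ℂ) = 1 / 2 := by simp
  rw [hhalf]
  rw [← sub_eq_zero] at hk' ⊢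
  rw [← hk']
  module

/-- The additive factor is a unit of `H∞`, because its Hermitian part dominates `S⁻¹ S^{-H}`. -/
theorem isHInftyUnit_additiveFactor (hA : S.A.IsSchur) (hF : S.PhiF.IsSchur) (hD : IsUnit S.D)
    {Sig : Matrix (Fin n) (Fin n) ℂ} (hSig : Sig.PosSemidef) (hStein : S.SteinEq Sig) :
    IsHInftyUnit (S.additiveFactor Sig).transfer := by
  obtain ⟨-, M, hM⟩ := isHInfty_transfer hA
  -- Taking `p = q`, the extra term is `(|q|² - 1) W Σ_F Wᴴ ⪰ 0` and may be dropped.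
  have hre : ∀ q : ℂ, 1 < ‖q‖ → ∀ v : Fin m → ℂ,
      (∑ k, ‖((S.inverse.transfer q)ᴴ *ᵥ v) k‖ ^ 2) ≤
        2 * (star v ⬝ᵥ ((S.additiveFactor Sig).transfer q *ᵥ v)).re := by
    intro q hq v
    have h1 := additiveFactor_add hSig.1 hStein (hF q hq.le) (hF q hq.le)
    obtain ⟨W, hW⟩ : ∃ W, W = S.D⁻¹ * S.C * (q • (1 : Matrix (Fin n) (Fin n) ℂ) - S.PhiF)⁻¹ :=
      ⟨_, rfl⟩
    rw [← hW] at h1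
    have h2 : q * star q - 1 = ((‖q‖ ^ 2 - 1 : ℝ) : ℂ) := by
      rw [Complex.star_def, Complex.mul_conj, Complex.normSq_eq_norm_sq]
      push_cast
      rfl
    have h3 := congrArg (fun Z => (star v ⬝ᵥ (Z *ᵥ v)).re) h1
    simp only [add_mulVec, dotProduct_add, Complex.add_re, smul_mulVec, dotProduct_smul, h2,
      smul_eq_mul, Complex.re_ofReal_mul] at h3
    have h4 : star v ⬝ᵥ (((S.additiveFactor Sig).transfer q)ᴴ *ᵥ v) =
        star (star v ⬝ᵥ ((S.additiveFactor Sig).transfer q *ᵥ v)) := by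
      rw [← star_dotProduct_star, star_star, star_mulVec, ← dotProduct_mulVec]
    have h5 : star v ⬝ᵥ ((S.inverse.transfer q * (S.inverse.transfer q)ᴴ) *ᵥ v) =
        ((∑ k, ‖((S.inverse.transfer q)ᴴ *ᵥ v) k‖ ^ 2 : ℝ) : ℂ) := by
      rw [← mulVec_mulVec, dotProduct_mulVec, ← conjTranspose_conjTranspose (S.inverse.transfer q),
        ← star_mulVec, conjTranspose_conjTranspose, dotProduct]
      push_cast
      exact Finset.sum_congr rfl fun k _ => Complex.conj_mul' _
    have h6 := (Complex.nonneg_iff.1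
      ((hSig.mul_mul_conjTranspose_same W).dotProduct_mulVec_nonneg v)).1
    rw [h4, h5, Complex.star_def, Complex.conj_re, Complex.ofReal_re] at h3
    have h7 : 0 ≤ ‖q‖ ^ 2 - 1 := by nlinarith
    nlinarith [mul_nonneg h7 h6]
  have hinv : ∀ q : ℂ, 1 < ‖q‖ → ∀ v : Fin m → ℂ,
      v = (S.transfer q)ᴴ *ᵥ ((S.inverse.transfer q)ᴴ *ᵥ v) := fun q hq v => by
    rw [mulVec_mulVec, ← conjTranspose_mul, mul_eq_one_comm.1
      (transfer_mul_transfer_inverse hD (hA q hq.le) (hF q hq.le)), conjTranspose_one, one_mulVec]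
  have hU : ∀ q : ℂ, 1 < ‖q‖ → IsUnit ((S.additiveFactor Sig).transfer q) := fun q hq => by
    refine isUnit_of_forall_mulVec fun v hv => ?_
    have h1 := hre q hq v
    rw [hv, dotProduct_zero, Complex.zero_re, mul_zero] at h1
    have h2 : (S.inverse.transfer q)ᴴ *ᵥ v = 0 := funext fun k => by
      have h3 := (Finset.single_le_sum (f := fun k => ‖((S.inverse.transfer q)ᴴ *ᵥ v) k‖ ^ 2)
        (fun k _ => by positivity) (Finset.mem_univ k)).trans h1
      have h4 : ‖((S.inverse.transfer q)ᴴ *ᵥ v) k‖ ^ 2 = 0 := le_antisymm h3 (by positivity)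
      simpa using h4
    rw [hinv q hq v, h2, mulVec_zero]
  have hopen : IsOpen {q : ℂ | 1 < ‖q‖} := isOpen_lt continuous_const continuous_norm
  refine ⟨isHInfty_transfer (G := S.additiveFactor Sig) hF, hU, fun i j =>
    DifferentiableOn.analyticOnNhd (fun q hq => (differentiableAt_transfer_inv_apply
      (S.additiveFactor Sig) (hF q (le_of_lt hq)) (hU q hq) i j).differentiableWithinAt) hopen,
    2 * (m * M ^ 2), fun q hq i j => ?_⟩
  -- For the `j`-th column `v` of `F⁻¹`, the form `Re ⟪v, F v⟫` is just the real part of `v j`, so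
  -- `a = S⁻ᴴ v` has `‖a‖² ≤ 2 |v j|`. Going back by `v = Sᴴ a` bounds `|v i|²` linearly in `|v j|`;
  -- the case `i = j` yields the constant `2 m M²`.
  obtain ⟨v, hv⟩ : ∃ v, v = ((S.additiveFactor Sig).transfer q)⁻¹ *ᵥ Pi.single j 1 := ⟨_, rfl⟩
  have hvi : ∀ i, ((S.additiveFactor Sig).transfer q)⁻¹ i j = v i := fun i => by
    rw [hv, mulVec_single_one]
    rfl
  have hFv : (S.additiveFactor Sig).transfer q *ᵥ v = Pi.single j 1 := by
    rw [hv, mulVec_mulVec, mul_nonsing_inv _ ((isUnit_iff_isUnit_det _).1 (hU q hq)), one_mulVec]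
  obtain ⟨a, ha⟩ : ∃ a, a = (S.inverse.transfer q)ᴴ *ᵥ v := ⟨_, rfl⟩
  have hsum : ∑ k, ‖a k‖ ^ 2 ≤ 2 * ‖v j‖ := by
    refine ha ▸ (hre q hq v).trans ?_
    rw [hFv, dotProduct_single, mul_one]
    have := Complex.re_le_norm (star v j)
    rw [Pi.star_apply, norm_star] at this
    rw [Pi.star_apply]
    linarith
  have hle : ∀ i, ‖v i‖ ^ 2 ≤ m * M ^ 2 * (2 * ‖v j‖) := fun i => by
    have h1 : ‖v i‖ ≤ ∑ k, M * ‖a k‖ := by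
      conv_lhs => rw [hinv q hq v, ← ha]
      rw [mulVec, dotProduct]
      refine (norm_sum_le _ _).trans (Finset.sum_le_sum fun k _ => ?_)
      rw [norm_mul, conjTranspose_apply, norm_star]
      exact mul_le_mul_of_nonneg_right (hM q hq k i) (norm_nonneg _)
    rw [← Finset.mul_sum] at h1
    have h2 := sq_sum_le_card_mul_sum_sq (s := Finset.univ) (f := fun k => ‖a k‖)
    rw [Finset.card_univ, Fintype.card_fin] at h2
    calc ‖v i‖ ^ 2 ≤ (M * ∑ k, ‖a k‖) ^ 2 := by gcongr
      _ = M ^ 2 * (∑ k, ‖a k‖) ^ 2 := mul_pow _ _ _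
      _ ≤ M ^ 2 * (m * (2 * ‖v j‖)) := by gcongr; exact h2.trans (by gcongr)
      _ = _ := by ring
  have hj : ‖v j‖ ≤ 2 * (m * M ^ 2) := by
    by_contra! hlt
    have := hle j
    have h0 : 0 ≤ 2 * (m * M ^ 2) := by positivity
    nlinarith
  refine (congrArg norm (hvi i)).trans_le ?_
  refine abs_le_of_sq_le_sq' ?_ (by positivity) |>.2
  calc ‖v i‖ ^ 2 ≤ m * M ^ 2 * (2 * ‖v j‖) := hle i
    _ ≤ m * M ^ 2 * (2 * (2 * (m * M ^ 2))) := by gcongr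
    _ = _ := by ring

end Realization

/-! ### The spectral factorization identity and the inverse formula. -/

namespace Plant

variable {nP nw nu nz : ℕ} {P : Plant nP nw nu nz}

/-- The spectral factorization `P + P^∼ + ε I = S^∼ S` at a pair of reflected points. -/
theorem tildeRealization_add {ε τ : ℝ} {SigP : Matrix (Fin nP) (Fin nP) ℂ}
    {PiS : Matrix (Fin nu) (Fin nP) ℂ} {DelS : Matrix (Fin nu) (Fin nu) ℂ}
    (h : P.IsPRFactorization ε τ SigP PiS DelS) {p q : ℂ} (hpq : star p * q = 1)
    (hp : IsUnit (p • (1 : Matrix (Fin nP) (Fin nP) ℂ) - P.Phi τ))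
    (hq : IsUnit (q • (1 : Matrix (Fin nP) (Fin nP) ℂ) - P.Phi τ)) :
    (P.tildeRealization τ).transfer q + ((P.tildeRealization τ).transfer p)ᴴ +
        (ε : ℂ) • (1 : Matrix (Fin nu) (Fin nu) ℂ) =
      ((P.spectralFactor τ PiS DelS).transfer p)ᴴ * (P.spectralFactor τ PiS DelS).transfer q := by
  obtain ⟨hSig, hblk⟩ := h
  rw [fromRows_mul_fromCols, fromBlocks_neg, fromBlocks_inj] at hblk
  obtain ⟨h11, h12, h21, h22⟩ := hblk
  have e11 : PiSᴴ * PiS = SigP - (P.Phi τ)ᴴ * SigP * P.Phi τ := by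
    rw [← neg_inj, ← h11]; abel
  have e12 : PiSᴴ * DelS = (P.PiY τ)ᴴ - (P.Phi τ)ᴴ * SigP * P.GammaU τ := by
    rw [← neg_inj, ← h12]; abel
  have e21 : DelSᴴ * PiS = P.PiY τ - (P.GammaU τ)ᴴ * SigP * P.Phi τ := by
    rw [← neg_inj, ← h21]; abel
  have e22 : DelSᴴ * DelS = P.DeltaUY τ + (P.DeltaUY τ)ᴴ + (ε : ℂ) • 1 -
      (P.GammaU τ)ᴴ * SigP * P.GammaU τ := by
    rw [← neg_inj, ← h22]; abel
  -- The same resolvent bookkeeping as for the additive factor, now for `Σ_P`; the relation `p̄ q =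
  -- 1` turns `p̄ q Σ_P` into `Σ_P`.
  have key : ∀ X Y : Matrix (Fin nP) (Fin nP) ℂ,
      (q • (1 : Matrix (Fin nP) (Fin nP) ℂ) - P.Phi τ) * X = 1 →
      Yᴴ * (p • (1 : Matrix (Fin nP) (Fin nP) ℂ) - P.Phi τ)ᴴ = 1 →
      Yᴴ * (SigP - (P.Phi τ)ᴴ * SigP * P.Phi τ) * X =
        SigP * P.Phi τ * X + Yᴴ * (P.Phi τ)ᴴ * SigP + SigP := by
    intro X Y hX hY
    have f1 : SigP * P.Phi τ * X = Yᴴ * ((p • (1 : Matrix (Fin nP) (Fin nP) ℂ) - P.Phi τ)ᴴ *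
        (SigP * P.Phi τ)) * X := by
      rw [← Matrix.mul_assoc Yᴴ, hY, Matrix.one_mul]
    have f2 : Yᴴ * (P.Phi τ)ᴴ * SigP = Yᴴ * ((P.Phi τ)ᴴ * SigP *
        (q • (1 : Matrix (Fin nP) (Fin nP) ℂ) - P.Phi τ)) * X := by
      rw [Matrix.mul_assoc Yᴴ (_ * _) X, Matrix.mul_assoc (_ * _) _ X, hX, Matrix.mul_one,
        Matrix.mul_assoc]
    have f3 : SigP = Yᴴ * ((p • (1 : Matrix (Fin nP) (Fin nP) ℂ) - P.Phi τ)ᴴ * SigP *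
        (q • (1 : Matrix (Fin nP) (Fin nP) ℂ) - P.Phi τ)) * X := by
      rw [← Matrix.mul_assoc Yᴴ, ← Matrix.mul_assoc Yᴴ, hY, Matrix.one_mul, Matrix.mul_assoc, hX,
        Matrix.mul_one]
    conv_rhs => rw [f1, f2]; enter [2]; rw [f3]
    simp only [conjTranspose_sub, conjTranspose_smul, conjTranspose_one, Matrix.mul_sub,
      Matrix.sub_mul, Matrix.mul_smul, Matrix.smul_mul, Matrix.mul_one, Matrix.one_mul,
      Matrix.mul_assoc, smul_sub, smul_smul]
    rw [mul_comm q (star p), hpq, one_smul]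
    abel
  have hk := key (q • 1 - P.Phi τ)⁻¹ (p • 1 - P.Phi τ)⁻¹
    (mul_nonsing_inv _ ((isUnit_iff_isUnit_det _).1 hq)) (by
      rw [← conjTranspose_mul, mul_nonsing_inv _ ((isUnit_iff_isUnit_det _).1 hp),
        conjTranspose_one])
  simp only [Realization.transfer, tildeRealization, spectralFactor]
  generalize (q • (1 : Matrix (Fin nP) (Fin nP) ℂ) - P.Phi τ)⁻¹ = X at *
  generalize (p • (1 : Matrix (Fin nP) (Fin nP) ℂ) - P.Phi τ)⁻¹ = Y at *
  have hk' := congrArg (fun Z => (P.GammaU τ)ᴴ * Z * P.GammaU τ) hk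
  have hexp : (PiS * Y * P.GammaU τ + DelS)ᴴ * (PiS * X * P.GammaU τ + DelS) =
      (P.GammaU τ)ᴴ * (Yᴴ * (PiSᴴ * PiS) * X) * P.GammaU τ + (DelSᴴ * PiS) * X * P.GammaU τ +
        (P.GammaU τ)ᴴ * Yᴴ * (PiSᴴ * DelS) + DelSᴴ * DelS := by
    simp only [conjTranspose_add, conjTranspose_mul, Matrix.mul_add, Matrix.add_mul,
      Matrix.mul_assoc]
    abel
  rw [hexp, e11, e12, e21, e22, hk]
  simp only [conjTranspose_add, conjTranspose_mul, Matrix.mul_add, Matrix.add_mul, Matrix.mul_sub,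
    Matrix.sub_mul, Matrix.mul_assoc]
  abel

/-- The bracket equals `S(p)ᴴ S(q)` and the sum of additive factors equals `S(q)⁻¹ S(p)⁻ᴴ`. Keeping
`p` and `q` separate covers both `p = 1 / q̄` off the circle and `p = q` on it. -/
theorem inv_add_eq {ε τ : ℝ} {SigP : Matrix (Fin nP) (Fin nP) ℂ}
    {PiS : Matrix (Fin nu) (Fin nP) ℂ} {DelS : Matrix (Fin nu) (Fin nu) ℂ}
    (h : P.IsPRFactorization ε τ SigP PiS DelS) (hτ : 0 < τ)
    (hN : IsUnit (1 - (2 * (τ : ℂ)) • P.A)) (hD : IsUnit DelS)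
    {SigF : Matrix (Fin nP) (Fin nP) ℂ} (hSig : SigF.IsHermitian)
    (hStein : (P.spectralFactor τ PiS DelS).SteinEq SigF) {p q : ℂ} (hpq : star p * q = 1)
    (hp1 : p ≠ -1) (hq1 : q ≠ -1)
    (hp : IsUnit (p • (1 : Matrix (Fin nP) (Fin nP) ℂ) - P.Phi τ))
    (hq : IsUnit (q • (1 : Matrix (Fin nP) (Fin nP) ℂ) - P.Phi τ))
    (hpF : IsUnit (p • (1 : Matrix (Fin nP) (Fin nP) ℂ) - (P.spectralFactor τ PiS DelS).PhiF))
    (hqF : IsUnit (q • (1 : Matrix (Fin nP) (Fin nP) ℂ) - (P.spectralFactor τ PiS DelS).PhiF)) :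
    IsUnit (P.tildePuy τ q + (P.tildePuy τ p)ᴴ + (ε : ℂ) • (1 : Matrix (Fin nu) (Fin nu) ℂ)) ∧
    (P.tildePuy τ q + (P.tildePuy τ p)ᴴ + (ε : ℂ) • (1 : Matrix (Fin nu) (Fin nu) ℂ))⁻¹ =
      (((P.spectralFactor τ PiS DelS).additiveFactor SigF).transfer p)ᴴ +
        ((P.spectralFactor τ PiS DelS).additiveFactor SigF).transfer q := by
  have h1 := tildeRealization_add h hpq hp hq
  rw [← tildePuy_eq hτ hN hq1 hq, ← tildePuy_eq hτ hN hp1 hp] at h1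
  have h2 := Realization.additiveFactor_add hSig hStein hpF hqF
  rw [mul_comm q, hpq, sub_self, zero_smul, add_zero] at h2
  have hSp := Realization.transfer_mul_transfer_inverse (S := P.spectralFactor τ PiS DelS) hD hp hpF
  have hSq := Realization.transfer_mul_transfer_inverse (S := P.spectralFactor τ PiS DelS) hD hq hqF
  have h3 : (P.tildePuy τ q + (P.tildePuy τ p)ᴴ + (ε : ℂ) • (1 : Matrix (Fin nu) (Fin nu) ℂ)) *
      ((((P.spectralFactor τ PiS DelS).additiveFactor SigF).transfer p)ᴴ +
        ((P.spectralFactor τ PiS DelS).additiveFactor SigF).transfer q) = 1 := by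
    rw [add_comm (_ᴴ), h2, h1, Matrix.mul_assoc, ← Matrix.mul_assoc _ _ (_ᴴ), hSq, Matrix.one_mul,
      ← conjTranspose_mul, mul_eq_one_comm.1 hSp, conjTranspose_one]
  exact ⟨IsUnit.of_mul_eq_one _ h3, inv_eq_right_inv h3⟩

end Plant

theorem mainTheorem6 {nP nw nu nz : ℕ} (P : Plant nP nw nu nz)
    (hmin : P.toRealization.IsMinimal) (hgain : P.HasBoundedGain) (hpass : P.IsPassive)
    (ε τ : ℝ) (hε : 0 < ε) (hτ : 0 < τ) :
    (∃ (SigP : Matrix (Fin nP) (Fin nP) ℂ) (PiS : Matrix (Fin nu) (Fin nP) ℂ)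
        (DelS : Matrix (Fin nu) (Fin nu) ℂ),
      P.IsPRFactorization ε τ SigP PiS DelS ∧
      IsHInftyUnit (P.spectralFactor τ PiS DelS).transfer) ∧
    ∀ (SigP : Matrix (Fin nP) (Fin nP) ℂ) (PiS : Matrix (Fin nu) (Fin nP) ℂ)
        (DelS : Matrix (Fin nu) (Fin nu) ℂ),
      P.IsPRFactorization ε τ SigP PiS DelS →
      IsHInftyUnit (P.spectralFactor τ PiS DelS).transfer →
      IsUnit DelS ∧
      ∃ SigF : Matrix (Fin nP) (Fin nP) ℂ,
        SigF.IsHermitian ∧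
        (P.spectralFactor τ PiS DelS).SteinEq SigF ∧
        (∀ X, (P.spectralFactor τ PiS DelS).SteinEq X → X = SigF) ∧
        IsHInftyUnit ((P.spectralFactor τ PiS DelS).additiveFactor SigF).transfer ∧
        (∀ q : ℂ, 1 < ‖q‖ →
          (star q)⁻¹ ∉ spectrum ℂ (P.Phi τ) →
          (star q)⁻¹ ∉ spectrum ℂ (P.spectralFactor τ PiS DelS).PhiF →
          IsUnit (P.tildePuy τ q + paraConj (P.tildePuy τ) q + (ε : ℂ) • (1 : Matrix (Fin nu) (Fin nu) ℂ)) ∧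
          (P.tildePuy τ q + paraConj (P.tildePuy τ) q + (ε : ℂ) • (1 : Matrix (Fin nu) (Fin nu) ℂ))⁻¹ =
            paraConj ((P.spectralFactor τ PiS DelS).additiveFactor SigF).transfer q +
              ((P.spectralFactor τ PiS DelS).additiveFactor SigF).transfer q) ∧
        (∀ q : ℂ, ‖q‖ = 1 → q ≠ -1 →
          IsUnit (P.tildePuy τ q + (P.tildePuy τ q)ᴴ + (ε : ℂ) • (1 : Matrix (Fin nu) (Fin nu) ℂ)) ∧
          (P.tildePuy τ q + (P.tildePuy τ q)ᴴ + (ε : ℂ) • (1 : Matrix (Fin nu) (Fin nu) ℂ))⁻¹ =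
            (((P.spectralFactor τ PiS DelS).additiveFactor SigF).transfer q)ᴴ +
              ((P.spectralFactor τ PiS DelS).additiveFactor SigF).transfer q) := by
  have hΦ := Plant.isSchur_Phi hmin hgain hτ
  have hN := Plant.isUnit_one_sub_smul_A hmin hgain hτ
  refine ⟨Plant.exists_isPRFactorization hmin hgain hpass hε hτ,
    fun SigP PiS DelS hfac hS => ?_⟩
  have hD : IsUnit DelS := Realization.isUnit_D_of_isHInftyUnit hS
  have hF := Realization.isSchur_PhiF (S := P.spectralFactor τ PiS DelS) hΦ hS
  obtain ⟨SigF, hSigF⟩ := hF.exists_stein (P.GammaU τ * DelS⁻¹ * (DelS⁻¹)ᴴ * (P.GammaU τ)ᴴ)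
  have hQ : (P.GammaU τ * DelS⁻¹ * (DelS⁻¹)ᴴ * (P.GammaU τ)ᴴ).PosSemidef := by
    have := posSemidef_self_mul_conjTranspose (P.GammaU τ * DelS⁻¹)
    rwa [conjTranspose_mul, ← Matrix.mul_assoc] at this
  have hpsd := hF.stein_posSemidef hQ hSigF
  refine ⟨hD, SigF, hpsd.1, hSigF, fun X hX => hF.stein_unique hX hSigF,
    Realization.isHInftyUnit_additiveFactor hΦ hF hD hpsd hSigF, fun q hq h1 h2 => ?_,
    fun q hq h1 => ?_⟩
  · rw [notMem_spectrum_iff] at h1 h2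
    have hq0 : q ≠ 0 := norm_pos_iff.1 (by linarith)
    refine Plant.inv_add_eq hfac hτ hN hD hpsd.1 hSigF (p := (star q)⁻¹) ?_ (fun h => ?_)
      (fun h => ?_) h1 (hΦ q hq.le) h2 (hF q hq.le)
    · rw [star_inv₀, star_star, inv_mul_cancel₀ hq0]
    · have h3 := congrArg norm h
      rw [norm_inv, norm_star, norm_neg, norm_one, inv_eq_one] at h3
      linarith
    · rw [h, norm_neg, norm_one] at hq
      exact lt_irrefl _ hq
  · refine Plant.inv_add_eq hfac hτ hN hD hpsd.1 hSigF (p := q) ?_ h1 h1 (hΦ q hq.ge)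
      (hΦ q hq.ge) (hF q hq.ge) (hF q hq.ge)
    rw [Complex.star_def, Complex.conj_mul', hq]
    norm_num
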